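/- Let $(\mathcal A,[\cdot,\cdot],\rho)$ be a Lie algebroid over a smooth manifold $M$, let $E$ be a (smooth, real) vector bundle over $M$, and let $\Omega^k(\mathcal A,E)=\Gamma(\wedge^k\mathcal A^*\otimes E)$, viewed as the space of skew-symmetric $C^\infty(M)$-multilinear maps $\Gamma(\mathcal A)^k\to\Gamma(E)$, and $\Omega^*(\mathcal A,E)=\bigoplus_{k\ge 0}\Omega^k(\mathcal A,E)$. Write $\mathrm{Sh}_{k_1,\dots,k_r}$ for the set of $(k_1,\dots,k_r)$-shuffles. An $\mathcal A$-connection on $E$ is an $\mathbb R$-bilinear map $\nabla\colon\Gamma(\mathcal A)\times\Gamma(E)\to\Gamma(E)$ that is $C^\infty(M)$-linear in the first argument and satisfies $\nabla_X(fs)=(\rho(X)f)s+f\nabla_Xs$. Its curvature is $R(X,Y)s=\nabla_X\nabla_Ys-\nabla_Y\nabla_Xs-\nabla_{[X,Y]}s$, and it is flat (a representation of $\mathcal A$) if $R=0$. An $\mathcal A$-connection on $\mathcal A$ is torsion-free if $\nabla_XY-\nabla_YX=[X,Y]$ for all $X,Y\in\Gamma(\mathcal A)$. For a connection on $E$ and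 $\omega\in\Omega^p(\mathcal A,E)$ put $$(d^\nabla\omega)(Z_1,\dots,Z_{p+1})=\sum_{\sigma\in\mathrm{Sh}_{1,p}}(-1)^\sigma\nabla_{Z_{\sigma(1)}}\bigl(\omega(Z_{\sigma(2)},\dots,Z_{\sigma(p+1)})\bigr)-\sum_{\sigma\in\mathrm{Sh}_{2,p-1}}(-1)^\sigma\omega\bigl([Z_{\sigma(1)},Z_{\sigma(2)}],Z_{\sigma(3)},\dots,Z_{\sigma(p+1)}\bigr).$$ For $\phi\in\Omega^k(\mathcal A,\mathcal A)$ let $i_\phi$ be the operator on $\Omega^*(\mathcal A,E)$ that is zero on $\Omega^0(\mathcal A,E)$ and, for $\omega\in\Omega^{m+1}(\mathcal A,E)$, is given by $$(i_\phi\omega)(Z_1,\dots,Z_{k+m})=\sum_{\sigma\in\mathrm{Sh}_{k,m}}(-1)^\sigma\omega\bigl(\phi(Z_{\sigma(1)},\dots,Z_{\sigma(k)}),Z_{\sigma(k+1)},\dots,Z_{\sigma(k+m)}\bigr).$$ Fix an $\mathcal A$-connection on $\mathcal A$ and one on $E$. For $\phi\in\Omega^k(\mathcal A,\mathcal A)$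 define on $\Omega^*(\mathcal A,E)$ $$\mathcal L^\nabla_\phi=i_\phi d^\nabla+(-1)^kd^\nabla i_\phi,\qquad \nabla_\phi=\mathcal L^\nabla_\phi-(-1)^k\,i_{d^\nabla\phi},$$ where $d^\nabla\phi$ is formed with the connection on $\mathcal A$ and $\mathcal L^\nabla_\phi$ with the connection on $E$; on $\Omega^*(\mathcal A,\mathcal A)$ both are formed with the connection on $\mathcal A$. With $R$ the curvature of the connection on $\mathcal A$, define $R(\phi,\psi)\in\Omega^{k+l+1}(\mathcal A,\mathcal A)$ for $\phi\in\Omega^k(\mathcal A,\mathcal A)$, $\psi\in\Omega^l(\mathcal A,\mathcal A)$ by $$R(\phi,\psi)(Y_1,\dots,Y_{k+l+1})=\sum_{\sigma\in\mathrm{Sh}_{k,l,1}}(-1)^\sigma R\bigl(\phi(Y_{\sigma(1)},\dots,Y_{\sigma(k)}),\psi(Y_{\sigma(k+1)},\dots,Y_{\sigma(k+l)})\bigr)Y_{\sigma(k+l+1)}.$$ **Theorem.** Suppose that the $\mathcal A$-connection on $\mathcal A$ is torsion-free and that the $\mathcal A$-connection on $E$ is flat. Then for all $k,l\ge 0$,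 $\phi\in\Omega^k(\mathcal A,\mathcal A)$ and $\psi\in\Omega^l(\mathcal A,\mathcal A)$, the graded commutator $[\nabla_\phi,\nabla_\psi]=\nabla_\phi\nabla_\psi-(-1)^{kl}\nabla_\psi\nabla_\phi$ satisfies, as operators on $\Omega^*(\mathcal A,E)$, $$[\nabla_\phi,\nabla_\psi]=\nabla_{\nabla_\phi\psi}-(-1)^{kl}\nabla_{\nabla_\psi\phi}-i_{R(\phi,\psi)}.$$ -/

import Mathlib

open scoped Manifold ContDiff
open Bundle

noncomputable section

namespace LieAlgd

/-! ### Shuffles -/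

/-- The `(k, n - k)`-shuffles in the permutation group of `Fin n`: the permutations which are
increasing on the first `k` positions and increasing on the remaining ones. -/
def shuffles₂ (k n : ℕ) : Finset (Equiv.Perm (Fin n)) :=
  Finset.univ.filter fun σ => ∀ i j : Fin n, i < j →
    ((j : ℕ) < k ∨ k ≤ (i : ℕ)) → σ i < σ j

/-- The `(k, l, n - k - l)`-shuffles in the permutation group of `Fin n`. -/
def shuffles₃ (k l n : ℕ) : Finset (Equiv.Perm (Fin n)) :=
  Finset.univ.filter fun σ => ∀ i j : Fin n, i < j →
    ((j : ℕ) < k ∨ (k ≤ (i : ℕ) ∧ (j : ℕ) < k + l) ∨ k + l ≤ (i : ℕ)) → σ i < σ j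

/-! ### The formulas, for arbitrary modules

The next three definitions are the bare formulas for insertion, for the covariant exterior
derivative and for the form `R(φ, ψ)`; they are specialised to sections of vector bundles below. -/

section Formulas

variable {L N : Type*} [AddCommGroup N]

/-- `(i_φ ψ)(Z) = ∑_{σ ∈ Sh(k,m)} (-1)^σ ψ(φ(Z_σ(1), …, Z_σ(k)), Z_σ(k+1), …, Z_σ(k+m))`. -/
def insertFun {k m : ℕ} (φ : (Fin k → L) → L) (ψ : (Fin (m + 1) → L) → N)
    (Z : Fin (k + m) → L) : N :=
  ∑ σ ∈ shuffles₂ k (k + m), Equiv.Perm.sign σ •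
    ψ (Fin.cons (φ fun i => Z (σ (Fin.castAdd m i))) fun j => Z (σ (Fin.natAdd k j)))

/-- The second sum in the covariant exterior derivative,
`∑_{σ ∈ Sh(2,p-1)} (-1)^σ η([Z_σ(1), Z_σ(2)], Z_σ(3), …, Z_σ(p+1))`, an empty sum for `p = 0`. -/
def bracketSum (br : L → L → L) :
    {p : ℕ} → ((Fin p → L) → N) → (Fin (p + 1) → L) → N
  | 0, _, _ => 0
  | q + 1, η, Z => ∑ σ ∈ shuffles₂ 2 (q + 2), Equiv.Perm.sign σ •
      η (Fin.cons (br (Z (σ 0)) (Z (σ 1))) fun j => Z (σ j.succ.succ))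

/-- `(dη)(Z) = ∑_{σ ∈ Sh(1,p)} (-1)^σ ∇_{Z_σ(1)} (η(Z_σ(2), …, Z_σ(p+1)))
  - ∑_{σ ∈ Sh(2,p-1)} (-1)^σ η([Z_σ(1), Z_σ(2)], Z_σ(3), …, Z_σ(p+1))`. -/
def extDerivFun (nab : L → N → N) (br : L → L → L) {p : ℕ}
    (η : (Fin p → L) → N) (Z : Fin (p + 1) → L) : N :=
  (∑ σ ∈ shuffles₂ 1 (p + 1), Equiv.Perm.sign σ •
      nab (Z (σ 0)) (η fun j => Z (σ j.succ)))
    - bracketSum br η Z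

/-- `R(φ,ψ)(Y) = ∑_{σ ∈ Sh(k,l,1)} (-1)^σ
  R(φ(Y_σ(1), …, Y_σ(k)), ψ(Y_σ(k+1), …, Y_σ(k+l))) Y_σ(k+l+1)`. -/
def curvFun (R : N → N → N → N) {k l : ℕ} (φ : (Fin k → N) → N) (ψ : (Fin l → N) → N)
    (Y : Fin (k + l + 1) → N) : N :=
  ∑ σ ∈ shuffles₃ k l (k + l + 1), Equiv.Perm.sign σ •
    R (φ fun i => Y (σ (Fin.castAdd l i).castSucc))
      (ψ fun j => Y (σ (Fin.natAdd k j).castSucc)) (Y (σ (Fin.last (k + l))))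

end Formulas

/-! ### Helper facts: these formulas give alternating multilinear maps -/

section Helpers

theorem shuffle_sum_adj {L N : Type*} [AddCommGroup N] {n : ℕ} (same : Fin n → Fin n → Prop) [∀ i j, Decidable (same i j)]
    (G : (Fin n → L) → N)
    (hG : ∀ w i j, i < j → same i j → w i = w j → G w = 0)
    (v : Fin n → L) (t t' : Fin n) (htt : (t' : ℕ) = t + 1) (hv : v t = v t') :
    ∑ σ ∈ Finset.univ.filter (fun σ : Equiv.Perm (Fin n) =>
        ∀ i j : Fin n, i < j → same i j → σ i < σ j),
      Equiv.Perm.sign σ • G (fun i => v (σ i)) = 0 := by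
  classical
  have hne : t ≠ t' := by intro h; rw [h] at htt; omega
  have hvs : ∀ i, v (Equiv.swap t t' i) = v i := by
    intro i
    by_cases h1 : i = t
    · subst h1; rw [Equiv.swap_apply_left]; exact hv.symm
    by_cases h2 : i = t'
    · subst h2; rw [Equiv.swap_apply_right]; exact hv
    rw [Equiv.swap_apply_of_ne_of_ne h1 h2]
  have hneg : ∀ σ : Equiv.Perm (Fin n),
      Equiv.Perm.sign (Equiv.swap t t' * σ) • G (fun i => v ((Equiv.swap t t' * σ) i))
        = -(Equiv.Perm.sign σ • G (fun i => v (σ i))) := by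
    intro σ
    simp only [Equiv.Perm.mul_apply, hvs, Equiv.Perm.sign_mul, Equiv.Perm.sign_swap hne]
    simp [Units.smul_def]
  refine Finset.sum_involution (fun σ _ =>
    if G (fun i => v (σ i)) = 0 then σ else Equiv.swap t t' * σ) ?_ ?_ ?_ ?_
  · intro σ _
    by_cases h : G (fun i => v (σ i)) = 0
    · simp [h]
    · simp only [h, if_false]
      rw [hneg]; simp
  · intro σ _ h0
    have h : ¬ G (fun i => v (σ i)) = 0 := by
      intro h; exact h0 (by rw [h, smul_zero])
    simp only [h, if_false]
    intro h1
    have h2 : Equiv.swap t t' = 1 := by simpa using h1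
    exact hne (Equiv.swap_eq_one_iff.mp h2)
  · intro σ hσ
    by_cases h : G (fun i => v (σ i)) = 0
    · simpa [h] using hσ
    · simp only [h, if_false]
      simp only [Finset.mem_filter, Finset.mem_univ, true_and] at hσ ⊢
      intro i j hij hs
      have h1 := hσ i j hij hs
      have h2 : ¬ (σ i = t ∧ σ j = t') := by
        rintro ⟨ha, hb⟩
        exact h (hG _ i j hij hs (by rw [ha, hb, hv]))
      simp only [Equiv.Perm.mul_apply, Equiv.swap_apply_def]
      simp only [Fin.ext_iff, Fin.lt_def] at *
      split_ifs <;> omega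
  · intro σ _
    by_cases h : G (fun i => v (σ i)) = 0
    · simp [h]
    · simp only [h, if_false, Equiv.Perm.mul_apply, hvs]
      rw [← mul_assoc, Equiv.swap_mul_self, one_mul]

variable {L N : Type*} [AddCommGroup L] [AddCommGroup N]

/-- Additivity in each slot. -/
def SlotAdd {n : ℕ} (f : (Fin n → L) → N) : Prop :=
  ∀ (v : Fin n → L) (i : Fin n) (x y : L),
    f (Function.update v i (x + y)) = f (Function.update v i x) + f (Function.update v i y)

/-- Vanishing when two neighbouring entries agree. -/
def AdjZero {n : ℕ} (f : (Fin n → L) → N) : Prop :=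
  ∀ (v : Fin n → L) (t t' : Fin n), (t' : ℕ) = t + 1 → v t = v t' → f v = 0

theorem AdjZero.map_swap {n : ℕ} {f : (Fin n → L) → N} (ha : SlotAdd f) (hz : AdjZero f)
    (v : Fin n → L) (t t' : Fin n) (htt : (t' : ℕ) = t + 1) :
    f (fun i => v (Equiv.swap t t' i)) = - f v := by
  have hne : t ≠ t' := by intro h; rw [h] at htt; omega
  have key : ∀ x y : L, f (Function.update (Function.update v t x) t' y)
      + f (Function.update (Function.update v t y) t' x) = 0 := by
    intro x y
    have h0 := hz (Function.update (Function.update v t (x + y)) t' (x + y)) t t' htt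
      (by simp [hne])
    have hx := hz (Function.update (Function.update v t x) t' x) t t' htt (by simp [hne])
    have hy := hz (Function.update (Function.update v t y) t' y) t t' htt (by simp [hne])
    have e : ∀ z, f (Function.update (Function.update v t (x + y)) t' z)
        = f (Function.update (Function.update v t x) t' z)
          + f (Function.update (Function.update v t y) t' z) := by
      intro z
      have c : ∀ b : L, Function.update (Function.update v t b) t' z
          = Function.update (Function.update v t' z) t b :=
        fun b => Function.update_comm hne b z v
      rw [c, c, c, ha]
    rw [ha, e, e, hx, hy, zero_add, add_zero, add_comm] at h0
    exact h0
  have h := key (v t') (v t)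
  have e1 : Function.update (Function.update v t (v t')) t' (v t)
      = fun i => v (Equiv.swap t t' i) := by
    funext i
    by_cases h1 : i = t'
    · subst h1; simp
    by_cases h2 : i = t
    · subst h2; simp [hne]
    simp [h1, h2, Equiv.swap_apply_of_ne_of_ne h2 h1]
  have e2 : Function.update (Function.update v t (v t)) t' (v t') = v := by simp
  rw [e1, e2] at h
  exact eq_neg_of_add_eq_zero_left h

theorem AdjZero.map_perm {n : ℕ} {f : (Fin n → L) → N} (ha : SlotAdd f) (hz : AdjZero f)
    (σ : Equiv.Perm (Fin n)) :
    ∀ v : Fin n → L, f (fun i => v (σ i)) = Equiv.Perm.sign σ • f v := by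
  cases n with
  | zero =>
    intro v
    have : σ = 1 := Subsingleton.elim _ _
    subst this; simp
  | succ n =>
    have hσ : σ ∈ Submonoid.closure
        (Set.range fun i : Fin n ↦ Equiv.swap i.castSucc i.succ) := by
      rw [Equiv.Perm.mclosure_swap_castSucc_succ]; trivial
    induction hσ using Submonoid.closure_induction with
    | mem x hx =>
      obtain ⟨i, rfl⟩ := hx
      intro v
      have hne : i.castSucc ≠ i.succ := Fin.castSucc_lt_succ.ne
      rw [hz.map_swap ha v _ _ (by simp), Equiv.Perm.sign_swap hne]
      simp [Units.smul_def]
    | one => intro v; simp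
    | mul x y _ _ hx hy =>
      intro v
      have := hy (fun i => v (x i))
      simp only [Equiv.Perm.mul_apply]
      rw [this, hx, Equiv.Perm.sign_mul, smul_smul, mul_comm]

theorem AdjZero.alt {n : ℕ} {f : (Fin n → L) → N} (ha : SlotAdd f) (hz : AdjZero f)
    (v : Fin n → L) (i j : Fin n) (hv : v i = v j) (hij : i ≠ j) : f v = 0 := by
  wlog h : i < j generalizing i j
  · exact this j i hv.symm hij.symm (lt_of_le_of_ne (not_lt.mp h) hij.symm)
  have hn : (i : ℕ) + 1 < n := by have := j.2; simp only [Fin.lt_def] at h; omega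
  have h1 := hz.map_perm ha (Equiv.swap ⟨i + 1, hn⟩ j) v
  have h2 : f (fun a => v (Equiv.swap ⟨i + 1, hn⟩ j a)) = 0 := by
    refine hz _ i ⟨i + 1, hn⟩ rfl ?_
    rw [Equiv.swap_apply_left, Equiv.swap_apply_of_ne_of_ne _ hij, hv]
    simp [Fin.ext_iff]
  rw [h2] at h1
  exact (smul_eq_zero_iff_eq _).mp h1.symm

/-- An alternating map out of a function that is linear in each slot and vanishes when two
neighbouring entries agree. -/
def mkAlt {S : Type*} [CommRing S] [Module S L] [Module S N] {n : ℕ} (f : (Fin n → L) → N)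
    (ha : SlotAdd f)
    (hs : ∀ (v : Fin n → L) (i : Fin n) (c : S) (x : L),
      f (Function.update v i (c • x)) = c • f (Function.update v i x))
    (hz : AdjZero f) : L [⋀^Fin n]→ₗ[S] N where
  toFun := f
  map_update_add' := by
    intro inst v i x y
    have e : inst = instDecidableEqFin n := Subsingleton.elim _ _
    subst e; exact ha v i x y
  map_update_smul' := by
    intro inst v i c x
    have e : inst = instDecidableEqFin n := Subsingleton.elim _ _
    subst e; exact hs v i c x
  map_eq_zero_of_eq' v i j hv hij := hz.alt ha v i j hv hij

theorem update_perm {L : Type*} {n : ℕ} (v : Fin n → L) (σ : Equiv.Perm (Fin n)) (i : Fin n) (x : L) :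
    (fun j => Function.update v i x (σ j))
      = Function.update (fun j => v (σ j)) (σ.symm i) x := by
  funext j
  by_cases h : σ j = i
  · subst h; simp
  · have : j ≠ σ.symm i := by rintro rfl; simp at h
    simp [h, this]

theorem SlotAdd.shuffle {n : ℕ} {G : (Fin n → L) → N} (hG : SlotAdd G)
    (S : Finset (Equiv.Perm (Fin n))) :
    SlotAdd fun v => ∑ σ ∈ S, Equiv.Perm.sign σ • G (fun i => v (σ i)) := by
  intro v i x y
  simp only [update_perm, hG _ _ x y, smul_add, Finset.sum_add_distrib]

theorem slotSmul_shuffle {S : Type*} [CommRing S] [Module S L] [Module S N] {n : ℕ}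
    {G : (Fin n → L) → N}
    (hG : ∀ (v : Fin n → L) (i : Fin n) (c : S) (x : L),
      G (Function.update v i (c • x)) = c • G (Function.update v i x))
    (T : Finset (Equiv.Perm (Fin n))) (v : Fin n → L) (i : Fin n) (c : S) (x : L) :
    (∑ σ ∈ T, Equiv.Perm.sign σ • G (fun j => Function.update v i (c • x) (σ j)))
      = c • ∑ σ ∈ T, Equiv.Perm.sign σ • G (fun j => Function.update v i x (σ j)) := by
  simp only [update_perm, hG, Finset.smul_sum, Units.smul_def]
  exact Finset.sum_congr rfl fun σ _ => smul_comm _ _ _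


theorem cons_update_succ {L : Type*} {m : ℕ} (a : L) (w : Fin m → L) (j : Fin m) (x : L) :
    (Fin.cons a (Function.update w j x) : Fin (m + 1) → L)
      = Function.update (Fin.cons a w) j.succ x := by
  exact Fin.cons_update (α := fun _ => L) a w j x

theorem cons_eq_update {L : Type*} {m : ℕ} (a b : L) (w : Fin m → L) :
    (Fin.cons a w : Fin (m + 1) → L) = Function.update (Fin.cons b w) 0 a := by
  exact (Fin.update_cons_zero (α := fun _ => L) b w a).symm

section Insert

variable {S : Type*} [CommRing S] [Module S L] [Module S N]

theorem cons_add {m : ℕ} (ψ : L [⋀^Fin (m + 1)]→ₗ[S] N) (a b : L) (w : Fin m → L) :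
    ψ (Fin.cons (a + b) w) = ψ (Fin.cons a w) + ψ (Fin.cons b w) := by
  rw [cons_eq_update (a + b) 0, cons_eq_update a 0, cons_eq_update b 0, ψ.map_update_add]

theorem cons_smul {m : ℕ} (ψ : L [⋀^Fin (m + 1)]→ₗ[S] N) (c : S) (a : L) (w : Fin m → L) :
    ψ (Fin.cons (c • a) w) = c • ψ (Fin.cons a w) := by
  rw [cons_eq_update (c • a) 0, cons_eq_update a 0, ψ.map_update_smul]

theorem update_castAdd {L : Type*} {k m : ℕ} (v : Fin (k + m) → L) (i : Fin k) (x : L) :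
    ((fun a => Function.update v (Fin.castAdd m i) x (Fin.castAdd m a))
        = Function.update (fun a => v (Fin.castAdd m a)) i x) ∧
      ((fun b => Function.update v (Fin.castAdd m i) x (Fin.natAdd k b))
        = fun b => v (Fin.natAdd k b)) := by
  constructor
  · funext a
    by_cases h : a = i
    · subst h; simp
    · simp [h]
  · funext b
    have : Fin.natAdd k b ≠ Fin.castAdd m i := by
      have := i.2
      simp only [ne_eq, Fin.ext_iff, Fin.val_natAdd, Fin.val_castAdd]; omega
    simp [this]

theorem update_natAdd {L : Type*} {k m : ℕ} (v : Fin (k + m) → L) (i : Fin m) (x : L) :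
    ((fun a => Function.update v (Fin.natAdd k i) x (Fin.castAdd m a))
        = fun a => v (Fin.castAdd m a)) ∧
      ((fun b => Function.update v (Fin.natAdd k i) x (Fin.natAdd k b))
        = Function.update (fun b => v (Fin.natAdd k b)) i x) := by
  constructor
  · funext a
    have : Fin.castAdd m a ≠ Fin.natAdd k i := by
      have := a.2
      simp only [ne_eq, Fin.ext_iff, Fin.val_natAdd, Fin.val_castAdd]; omega
    simp [this]
  · funext b
    by_cases h : b = i
    · subst h; simp
    · simp [h]

variable {k m : ℕ} (φ : L [⋀^Fin k]→ₗ[S] L) (ψ : L [⋀^Fin (m + 1)]→ₗ[S] N)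

theorem insert_base_add : SlotAdd fun w : Fin (k + m) → L =>
    ψ (Fin.cons (φ fun i => w (Fin.castAdd m i)) fun j => w (Fin.natAdd k j)) := by
  intro v i x y
  refine Fin.addCases (fun i => ?_) (fun i => ?_) i
  · simp only [update_castAdd, φ.map_update_add, cons_add]
  · simp only [update_natAdd, cons_update_succ, ψ.map_update_add]

theorem insert_base_smul (v : Fin (k + m) → L) (i : Fin (k + m)) (c : S) (x : L) :
    (fun w : Fin (k + m) → L =>
      ψ (Fin.cons (φ fun i => w (Fin.castAdd m i)) fun j => w (Fin.natAdd k j)))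
        (Function.update v i (c • x))
    = c • (fun w : Fin (k + m) → L =>
      ψ (Fin.cons (φ fun i => w (Fin.castAdd m i)) fun j => w (Fin.natAdd k j)))
        (Function.update v i x) := by
  refine Fin.addCases (fun i => ?_) (fun i => ?_) i
  · simp only [update_castAdd, φ.map_update_smul, cons_smul]
  · simp only [update_natAdd, cons_update_succ, ψ.map_update_smul]

theorem insertFun_adj : AdjZero (insertFun (k := k) (m := m) φ ψ) := by
  intro v t t' htt hv
  refine shuffle_sum_adj (fun i j : Fin (k + m) => (j : ℕ) < k ∨ k ≤ (i : ℕ))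
    (fun w => ψ (Fin.cons (φ fun i => w (Fin.castAdd m i)) fun j => w (Fin.natAdd k j)))
    ?_ v t t' htt hv
  intro w i j hij hs hw
  have hij' : (i : ℕ) < j := hij
  rcases hs with hs | hs
  · have h0 : (φ fun i => w (Fin.castAdd m i)) = 0 :=
      φ.map_eq_zero_of_eq _ (i := ⟨i, by omega⟩) (j := ⟨j, hs⟩) hw (by simp [Fin.ext_iff]; omega)
    rw [h0]
    exact ψ.map_coord_zero 0 rfl
  · refine ψ.map_eq_zero_of_eq _ (i := Fin.succ ⟨i - k, by omega⟩)
      (j := Fin.succ ⟨j - k, by omega⟩) ?_ (by simp [Fin.ext_iff]; omega)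
    simp only [Fin.cons_succ]
    convert hw using 2 <;> (simp [Fin.ext_iff]; omega)

/-- Insertion of a vector-valued `k`-form, on forms of positive degree. -/
def insertForm : L [⋀^Fin (k + m)]→ₗ[S] N :=
  mkAlt (insertFun φ ψ) ((insert_base_add φ ψ).shuffle _)
    (slotSmul_shuffle (G := fun w : Fin (k + m) → L =>
      ψ (Fin.cons (φ fun i => w (Fin.castAdd m i)) fun j => w (Fin.natAdd k j)))
      (insert_base_smul φ ψ) (shuffles₂ k (k + m)))
    (insertFun_adj φ ψ)

theorem insertForm_apply (Z : Fin (k + m) → L) : insertForm φ ψ Z = insertFun φ ψ Z := rfl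

end Insert

section ExtDeriv

variable {S : Type*} [CommRing S] [Module S L] [Module S N]
  {nab : L → N → N} {br : L → L → L} {a : L → S → S}

theorem nab_sum_adj {p : ℕ} (η : L [⋀^Fin p]→ₗ[S] N) (nab0 : ∀ x, nab x 0 = 0) :
    AdjZero fun v : Fin (p + 1) → L => ∑ σ ∈ shuffles₂ 1 (p + 1), Equiv.Perm.sign σ •
      nab (v (σ 0)) (η fun j => v (σ j.succ)) := by
  intro v t t' htt hv
  refine shuffle_sum_adj (fun i j : Fin (p + 1) => (j : ℕ) < 1 ∨ 1 ≤ (i : ℕ))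
    (fun w => nab (w 0) (η fun j => w j.succ)) ?_ v t t' htt hv
  intro w i j hij hs hw
  have hij' : (i : ℕ) < j := hij
  have h0 : (η fun j => w j.succ) = 0 := by
    refine η.map_eq_zero_of_eq _ (i := ⟨i - 1, by omega⟩) (j := ⟨j - 1, by omega⟩) ?_
      (by simp [Fin.ext_iff]; omega)
    convert hw using 2 <;> (simp [Fin.ext_iff]; omega)
  simp only [h0, nab0]

theorem bracketSum_adj (br_self : ∀ x, br x x = 0) : ∀ {p : ℕ} (η : L [⋀^Fin p]→ₗ[S] N),
    AdjZero (bracketSum br (p := p) η)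
  | 0, _ => fun _ _ _ _ _ => rfl
  | q + 1, η => by
    intro v t t' htt hv
    refine shuffle_sum_adj (fun i j : Fin (q + 2) => (j : ℕ) < 2 ∨ 2 ≤ (i : ℕ))
      (fun w => η (Fin.cons (br (w 0) (w 1)) fun j => w j.succ.succ)) ?_ v t t' htt hv
    intro w i j hij hs hw
    have hij' : (i : ℕ) < j := hij
    rcases hs with hs | hs
    · have hi : i = 0 := Fin.ext (by rw [Fin.val_zero]; omega)
      have hj : j = 1 := Fin.ext (by rw [Fin.val_one]; omega)
      subst hi hj
      rw [hw, br_self]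
      exact η.map_coord_zero 0 rfl
    · refine η.map_eq_zero_of_eq _ (i := Fin.succ ⟨i - 2, by omega⟩)
        (j := Fin.succ ⟨j - 2, by omega⟩) ?_ (by simp [Fin.ext_iff]; omega)
      simp only [Fin.cons_succ]
      convert hw using 2 <;> (simp [Fin.ext_iff]; omega)

theorem nab_base_add (nab_add : ∀ x y s, nab (x + y) s = nab x s + nab y s)
    (nab_add' : ∀ x s t, nab x (s + t) = nab x s + nab x t) {p : ℕ} (η : L [⋀^Fin p]→ₗ[S] N) :
    SlotAdd fun w : Fin (p + 1) → L => nab (w 0) (η fun j => w j.succ) := by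
  intro v i x y
  refine Fin.cases ?_ (fun i => ?_) i
  · simp [nab_add]
  · have h : ∀ z, (fun j : Fin p => Function.update v i.succ z j.succ)
        = Function.update (fun j => v j.succ) i z := by
      intro z; funext j
      by_cases h : j = i
      · subst h; simp
      · simp [h]
    have h0 : ∀ z, Function.update v i.succ z 0 = v 0 := fun z =>
      Function.update_of_ne (Fin.succ_ne_zero i).symm _ _
    simp only [h, h0, η.map_update_add, nab_add']

theorem bracketSum_add (br_add : ∀ x y z, br (x + y) z = br x z + br y z)
    (br_add' : ∀ x y z, br x (y + z) = br x y + br x z) :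
    ∀ {p : ℕ} (η : L [⋀^Fin p]→ₗ[S] N), SlotAdd (bracketSum br (p := p) η)
  | 0, _ => fun _ _ _ _ => by simp [bracketSum]
  | q + 1, η => by
    refine SlotAdd.shuffle (G := fun w : Fin (q + 2) → L =>
      η (Fin.cons (br (w 0) (w 1)) fun j => w j.succ.succ)) ?_ _
    intro v i x y
    refine Fin.cases ?_ (fun i => ?_) i
    · simp [br_add, cons_add]
    · refine Fin.cases ?_ (fun i => ?_) i
      · have h : ∀ z, (fun j : Fin q => Function.update v (Fin.succ 0) z j.succ.succ)
            = fun j => v j.succ.succ := by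
          intro z; funext j
          exact Function.update_of_ne (by simp [Fin.ext_iff]) _ _
        simp only [h]
        have h1 : ∀ z, Function.update v (Fin.succ 0) z 1 = z := fun z =>
          Function.update_self _ _ _
        have h0 : ∀ z, Function.update v (Fin.succ 0) z 0 = v 0 := fun z =>
          Function.update_of_ne (Fin.succ_ne_zero _).symm _ _
        simp only [h1, h0, br_add', cons_add]
      · have h : ∀ z, (fun j : Fin q => Function.update v i.succ.succ z j.succ.succ)
            = Function.update (fun j => v j.succ.succ) i z := by
          intro z; funext j
          by_cases h : j = i
          · subst h; simp
          · simp [h]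
        have h1 : ∀ z, Function.update v i.succ.succ z 1 = v 1 := fun z =>
          Function.update_of_ne (by simp [Fin.ext_iff]) _ _
        have h0 : ∀ z, Function.update v i.succ.succ z 0 = v 0 := fun z =>
          Function.update_of_ne (Fin.succ_ne_zero _).symm _ _
        simp only [h, h1, h0, cons_update_succ, η.map_update_add]


theorem update_zero_of_ne {L : Type*} {n : ℕ} (v : Fin (n + 1) → L) (b c : L) (i : Fin (n + 1))
    (h : i ≠ 0) : Function.update v 0 b i = Function.update v 0 c i := by
  rw [Function.update_of_ne h, Function.update_of_ne h]

/-- If `0` is at position `i` of `v ∘ τ`, changing `v 0` changes entry `i` only. -/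
theorem update_zero_comp {L : Type*} {n p : ℕ} (v : Fin (n + 1) → L) (b c : L)
    (τ : Fin p → Fin (n + 1)) (hτ : Function.Injective τ) (i : Fin p) (h : τ i = 0) :
    (fun j => Function.update v 0 b (τ j))
      = Function.update (fun j => Function.update v 0 c (τ j)) i b := by
  funext j
  by_cases hj : j = i
  · subst hj; simp [h]
  · rw [Function.update_of_ne hj]
    exact update_zero_of_ne v b c _ fun h' => hj (hτ (h'.trans h.symm))

theorem alt_update_zero_smul {n p : ℕ} (η : L [⋀^Fin p]→ₗ[S] N) (v : Fin (n + 1) → L)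
    (c : S) (x : L) (τ : Fin p → Fin (n + 1)) (hτ : Function.Injective τ) (i : Fin p)
    (h : τ i = 0) :
    η (fun j => Function.update v 0 (c • x) (τ j))
      = c • η (fun j => Function.update v 0 x (τ j)) := by
  rw [update_zero_comp v (c • x) x τ hτ i h, η.map_update_smul,
    ← update_zero_comp v x x τ hτ i h]

theorem nab_sum_smul (nab_smul : ∀ (c : S) x s, nab (c • x) s = c • nab x s)
    (nab_leib : ∀ x (c : S) s, nab x (c • s) = c • nab x s + a x c • s)
    {p : ℕ} (η : L [⋀^Fin p]→ₗ[S] N) (v : Fin (p + 1) → L) (c : S) (x : L) :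
    (∑ σ ∈ shuffles₂ 1 (p + 1), Equiv.Perm.sign σ •
        nab (Function.update v 0 (c • x) (σ 0))
          (η fun j => Function.update v 0 (c • x) (σ j.succ)))
      = c • (∑ σ ∈ shuffles₂ 1 (p + 1), Equiv.Perm.sign σ •
          nab (Function.update v 0 x (σ 0)) (η fun j => Function.update v 0 x (σ j.succ)))
        + ∑ σ ∈ (shuffles₂ 1 (p + 1)).filter (fun σ => σ 0 ≠ 0), Equiv.Perm.sign σ •
            a (Function.update v 0 x (σ 0)) c • η fun j => Function.update v 0 x (σ j.succ) := by
  rw [Finset.sum_filter, Finset.smul_sum, ← Finset.sum_add_distrib]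
  refine Finset.sum_congr rfl fun σ _ => ?_
  by_cases h : σ 0 = 0
  · have h1 : ∀ j : Fin p, σ j.succ ≠ 0 := fun j hj =>
      Fin.succ_ne_zero j (σ.injective (hj.trans h.symm))
    have h2 : (fun j : Fin p => Function.update v 0 (c • x) (σ j.succ))
        = fun j => Function.update v 0 x (σ j.succ) :=
      funext fun j => update_zero_of_ne v _ _ _ (h1 j)
    rw [h2, if_neg (not_not.mpr h), add_zero, h, Function.update_self, Function.update_self,
      nab_smul]
    simp only [Units.smul_def]
    exact smul_comm _ _ _
  · obtain ⟨i, hi⟩ : ∃ i : Fin p, σ i.succ = 0 := by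
      obtain ⟨i, hi⟩ := Fin.exists_succ_eq.mpr
        (show σ.symm 0 ≠ 0 from fun h' => h (by rw [← h', Equiv.apply_symm_apply, h']))
      exact ⟨i, by rw [hi, Equiv.apply_symm_apply]⟩
    rw [if_pos h, alt_update_zero_smul η v c x (fun j => σ j.succ)
      (σ.injective.comp (Fin.succ_injective _)) i hi, nab_leib,
      update_zero_of_ne v (c • x) x _ h, smul_add]
    congr 1
    simp only [Units.smul_def]
    exact smul_comm _ _ _

theorem bracketSum_smul (br_smul : ∀ (c : S) x y, br (c • x) y = c • br x y - a y c • x)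
    {q : ℕ} (η : L [⋀^Fin (q + 1)]→ₗ[S] N) (v : Fin (q + 2) → L) (c : S) (x : L) :
    bracketSum br η (Function.update v 0 (c • x))
      = c • bracketSum br η (Function.update v 0 x)
        - ∑ σ ∈ (shuffles₂ 2 (q + 2)).filter (fun σ => σ 0 = 0), Equiv.Perm.sign σ •
            a (Function.update v 0 x (σ 1)) c •
              η (Fin.cons x fun j => Function.update v 0 x (σ j.succ.succ)) := by
  simp only [bracketSum]
  rw [Finset.sum_filter, Finset.smul_sum, ← Finset.sum_sub_distrib]
  refine Finset.sum_congr rfl fun σ hσ => ?_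
  simp only [shuffles₂, Finset.mem_filter, Finset.mem_univ, true_and] at hσ
  have h01 : σ 0 < σ 1 := hσ 0 1 (by simp) (Or.inl (by simp))
  have hne1 : σ 1 ≠ 0 := fun h => by rw [h] at h01; exact absurd h01 (by simp)
  by_cases h : σ 0 = 0
  · have h1 : ∀ j : Fin q, σ j.succ.succ ≠ 0 := fun j hj =>
      Fin.succ_ne_zero j.succ (σ.injective (hj.trans h.symm))
    have h2 : (fun j : Fin q => Function.update v 0 (c • x) (σ j.succ.succ))
        = fun j => Function.update v 0 x (σ j.succ.succ) :=
      funext fun j => update_zero_of_ne v _ _ _ (h1 j)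
    rw [h2, if_pos h, h, Function.update_self, Function.update_self,
      update_zero_of_ne v (c • x) x _ hne1, br_smul, sub_eq_add_neg, cons_add, cons_smul,
      ← neg_smul, cons_smul, neg_smul, smul_add, smul_neg, ← sub_eq_add_neg]
    congr 1
    simp only [Units.smul_def]
    exact smul_comm _ _ _
  · obtain ⟨i, hi⟩ : ∃ i : Fin q, σ i.succ.succ = 0 := by
      obtain ⟨i, hi⟩ := Fin.exists_succ_eq.mpr
        (show σ.symm 0 ≠ 0 from fun h' => h (by rw [← h', Equiv.apply_symm_apply, h']))
      have hi0 : i ≠ 0 := by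
        rintro rfl
        apply hne1
        have : (1 : Fin (q + 2)) = Fin.succ 0 := rfl
        rw [this, hi, Equiv.apply_symm_apply]
      obtain ⟨i', rfl⟩ := Fin.exists_succ_eq.mpr hi0
      exact ⟨i', by rw [hi, Equiv.apply_symm_apply]⟩
    have hinj : Function.Injective fun j : Fin q => σ j.succ.succ :=
      σ.injective.comp ((Fin.succ_injective _).comp (Fin.succ_injective _))
    rw [if_neg h, sub_zero, update_zero_of_ne v (c • x) x _ h,
      update_zero_of_ne v (c • x) x _ hne1,
      update_zero_comp v (c • x) x (fun j : Fin q => σ j.succ.succ) hinj i hi,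
      cons_update_succ, η.map_update_smul, ← cons_update_succ,
      ← update_zero_comp v x x (fun j : Fin q => σ j.succ.succ) hinj i hi]
    simp only [Units.smul_def]
    exact smul_comm _ _ _

theorem correction_cancel {q : ℕ} (η : L [⋀^Fin (q + 1)]→ₗ[S] N) (v : Fin (q + 2) → L)
    (b : L → S) :
    (∑ σ ∈ (shuffles₂ 1 (q + 2)).filter (fun σ => σ 0 ≠ 0), Equiv.Perm.sign σ •
        b (v (σ 0)) • η fun j => v (σ j.succ))
      = - ∑ σ ∈ (shuffles₂ 2 (q + 2)).filter (fun σ => σ 0 = 0), Equiv.Perm.sign σ •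
          b (v (σ 1)) • η (Fin.cons (v 0) fun j => v (σ j.succ.succ)) := by
  have hs1 : ∀ σ ∈ (shuffles₂ 1 (q + 2)).filter (fun σ => σ 0 ≠ 0), σ 1 = 0 := by
    intro σ hσ
    simp only [shuffles₂, Finset.mem_filter, Finset.mem_univ, true_and] at hσ
    obtain ⟨hσ, h0⟩ := hσ
    by_contra h1
    have hk0 : σ.symm 0 ≠ 0 := fun h' => h0 (by rw [← h', Equiv.apply_symm_apply, h'])
    have hk1 : σ.symm 0 ≠ 1 := fun h' => h1 (by rw [← h', Equiv.apply_symm_apply])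
    have hlt : (1 : Fin (q + 2)) < σ.symm 0 := by
      simp only [ne_eq, Fin.ext_iff, Fin.val_zero, Fin.val_one, Fin.lt_def] at *; omega
    have := hσ 1 _ hlt (Or.inr (by simp))
    rw [Equiv.apply_symm_apply] at this
    exact absurd this (by simp)
  have h01 : (0 : Fin (q + 2)) ≠ 1 := by simp
  have hss0 : ∀ j : Fin q, j.succ.succ ≠ (0 : Fin (q + 2)) := fun j => Fin.succ_ne_zero _
  have hss1 : ∀ j : Fin q, j.succ.succ ≠ (1 : Fin (q + 2)) := fun j => by simp [Fin.ext_iff]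
  rw [← Finset.sum_neg_distrib]
  refine Finset.sum_nbij' (fun σ => σ * Equiv.swap 0 1) (fun σ => σ * Equiv.swap 0 1)
    ?_ ?_ ?_ ?_ ?_
  · intro σ hσ
    have h10 := hs1 σ hσ
    simp only [shuffles₂, Finset.mem_filter, Finset.mem_univ, true_and] at hσ ⊢
    obtain ⟨hσ, h0⟩ := hσ
    refine ⟨fun i j hij hs => ?_, by simp [h10]⟩
    rcases hs with hs | hs
    · have hi : i = 0 := Fin.ext (by rw [Fin.val_zero]; simp only [Fin.lt_def] at hij; omega)
      have hj : j = 1 := Fin.ext (by rw [Fin.val_one]; simp only [Fin.lt_def] at hij; omega)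
      subst hi hj
      simpa [h10] using Fin.pos_iff_ne_zero.mpr h0
    · have hj : 2 ≤ (j : ℕ) := by simp only [Fin.lt_def] at hij; omega
      have ni0 : i ≠ 0 := by rintro rfl; simp at hs
      have ni1 : i ≠ 1 := by rintro rfl; simp at hs
      have nj0 : j ≠ 0 := by rintro rfl; simp at hj
      have nj1 : j ≠ 1 := by rintro rfl; simp at hj
      simp only [Equiv.Perm.mul_apply, Equiv.swap_apply_of_ne_of_ne ni0 ni1,
        Equiv.swap_apply_of_ne_of_ne nj0 nj1]
      exact hσ i j hij (Or.inr (by omega))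
  · intro σ hσ
    simp only [shuffles₂, Finset.mem_filter, Finset.mem_univ, true_and] at hσ ⊢
    obtain ⟨hσ, h0⟩ := hσ
    have h1 : σ 1 ≠ 0 := fun h => h01 (σ.injective (h0.trans h.symm))
    refine ⟨fun i j hij hs => ?_, by simpa using h1⟩
    have hi : 1 ≤ (i : ℕ) := by
      simp only [Fin.lt_def] at hij
      omega
    have nj0 : j ≠ 0 := by rintro rfl; simp at hij
    have nj1 : j ≠ 1 := by
      rintro rfl; simp only [Fin.lt_def, Fin.val_one] at hij; omega
    simp only [Equiv.Perm.mul_apply, Equiv.swap_apply_of_ne_of_ne nj0 nj1]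
    by_cases ni1 : i = 1
    · subst ni1
      rw [Equiv.swap_apply_right, h0]
      exact Fin.pos_iff_ne_zero.mpr fun h => nj0 (σ.injective (h.trans h0.symm))
    · have ni0 : i ≠ 0 := by rintro rfl; simp at hi
      rw [Equiv.swap_apply_of_ne_of_ne ni0 ni1]
      refine hσ i j hij (Or.inr ?_)
      simp only [Fin.ext_iff, Fin.val_one] at ni1; omega
  · intro σ _; simp [mul_assoc]
  · intro σ _; simp [mul_assoc]
  · intro σ hσ
    have h10 := hs1 σ hσ
    have e : (fun j : Fin (q + 1) => v (σ j.succ))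
        = Fin.cons (v 0) fun j : Fin q => v ((σ * Equiv.swap 0 1 : Equiv.Perm (Fin (q + 2))) j.succ.succ) := by
      funext j
      refine Fin.cases ?_ (fun j => ?_) j
      · rw [Fin.cons_zero, ← h10]; rfl
      · rw [Fin.cons_succ, Equiv.Perm.mul_apply,
          Equiv.swap_apply_of_ne_of_ne (hss0 j) (hss1 j)]
    rw [e, Equiv.Perm.sign_mul, Equiv.Perm.sign_swap h01]
    simp [Units.smul_def]

theorem extDerivFun_add (nab_add : ∀ x y s, nab (x + y) s = nab x s + nab y s)
    (nab_add' : ∀ x s t, nab x (s + t) = nab x s + nab x t)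
    (br_add : ∀ x y z, br (x + y) z = br x z + br y z)
    (br_add' : ∀ x y z, br x (y + z) = br x y + br x z)
    {p : ℕ} (η : L [⋀^Fin p]→ₗ[S] N) : SlotAdd (extDerivFun nab br (p := p) η) := by
  intro v i x y
  have h1 := (nab_base_add nab_add nab_add' η).shuffle (shuffles₂ 1 (p + 1)) v i x y
  have h2 := bracketSum_add br_add br_add' η v i x y
  simp only [extDerivFun]
  rw [h2]
  simp only at h1
  rw [h1]
  abel

theorem extDerivFun_adj (nab_add' : ∀ x s t, nab x (s + t) = nab x s + nab x t)
    (br_self : ∀ x, br x x = 0) {p : ℕ} (η : L [⋀^Fin p]→ₗ[S] N) :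
    AdjZero (extDerivFun nab br (p := p) η) := by
  intro v t t' htt hv
  have nab0 : ∀ x, nab x 0 = 0 := fun x => by simpa using nab_add' x 0 0
  have h1 := nab_sum_adj η nab0 v t t' htt hv
  have h2 := bracketSum_adj br_self η v t t' htt hv
  simp only [extDerivFun]
  rw [h2, sub_zero]
  exact h1

theorem extDerivFun_smul_zero
    (nab_smul : ∀ (c : S) x s, nab (c • x) s = c • nab x s)
    (nab_leib : ∀ x (c : S) s, nab x (c • s) = c • nab x s + a x c • s)
    (br_smul : ∀ (c : S) x y, br (c • x) y = c • br x y - a y c • x)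
    {p : ℕ} (η : L [⋀^Fin p]→ₗ[S] N) (v : Fin (p + 1) → L) (c : S) (x : L) :
    extDerivFun nab br η (Function.update v 0 (c • x))
      = c • extDerivFun nab br η (Function.update v 0 x) := by
  have h1 := nab_sum_smul nab_smul nab_leib η v c x
  cases p with
  | zero =>
    have hz : ∀ σ : Equiv.Perm (Fin 1), σ 0 = 0 := fun σ => Subsingleton.elim _ _
    simp only [extDerivFun, bracketSum, sub_zero]
    rw [h1, Finset.filter_false_of_mem, Finset.sum_empty, add_zero]
    intro σ _
    simpa using hz σ
  | succ q =>
    have h2 := bracketSum_smul (a := a) br_smul η v c x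
    have h3 := correction_cancel η (Function.update v 0 x) (fun y => a y c)
    simp only [Function.update_self] at h3
    simp only [extDerivFun]
    rw [h1, h2, h3, smul_sub]
    abel

theorem extDerivFun_smul (nab_add : ∀ x y s, nab (x + y) s = nab x s + nab y s)
    (nab_add' : ∀ x s t, nab x (s + t) = nab x s + nab x t)
    (nab_smul : ∀ (c : S) x s, nab (c • x) s = c • nab x s)
    (nab_leib : ∀ x (c : S) s, nab x (c • s) = c • nab x s + a x c • s)
    (br_add : ∀ x y z, br (x + y) z = br x z + br y z)
    (br_add' : ∀ x y z, br x (y + z) = br x y + br x z)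
    (br_self : ∀ x, br x x = 0)
    (br_smul : ∀ (c : S) x y, br (c • x) y = c • br x y - a y c • x)
    {p : ℕ} (η : L [⋀^Fin p]→ₗ[S] N) (v : Fin (p + 1) → L) (i : Fin (p + 1)) (c : S) (x : L) :
    extDerivFun nab br η (Function.update v i (c • x))
      = c • extDerivFun nab br η (Function.update v i x) := by
  have ha : SlotAdd (extDerivFun nab br (p := p) η) :=
    extDerivFun_add nab_add nab_add' br_add br_add' η
  have hz : AdjZero (extDerivFun nab br (p := p) η) := extDerivFun_adj nab_add' br_self η
  have key : ∀ z, extDerivFun nab br η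
      (Function.update (fun j => v (Equiv.swap 0 i j)) 0 z)
      = Equiv.Perm.sign (Equiv.swap 0 i) • extDerivFun nab br η (Function.update v i z) := by
    intro z
    rw [← hz.map_perm ha, update_perm]
    simp
  have h := extDerivFun_smul_zero nab_smul nab_leib br_smul η
    (fun j => v (Equiv.swap 0 i j)) c x
  rw [key, key, Units.smul_def, Units.smul_def, smul_comm, ← Units.smul_def,
    ← Units.smul_def] at h
  exact smul_left_cancel _ h

end ExtDeriv

section Curv

variable {S : Type*} [CommRing S] [Module S L] {R : L → L → L → L} {k l : ℕ}


variable (φ : L [⋀^Fin k]→ₗ[S] L) (ψ : L [⋀^Fin l]→ₗ[S] L)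

theorem update_castSucc {L : Type*} {n : ℕ} (v : Fin (n + 1) → L) (i : Fin n) (x : L) :
    ((fun a : Fin n => Function.update v i.castSucc x a.castSucc)
        = Function.update (fun a => v a.castSucc) i x) ∧
      Function.update v i.castSucc x (Fin.last n) = v (Fin.last n) := by
  constructor
  · funext a
    by_cases h : a = i
    · subst h; simp
    · simp [h]
  · exact Function.update_of_ne (Fin.castSucc_lt_last i).ne' _ _

/-- The summand of `curvFun` as a function of the permuted arguments. -/
def curvBase (R : L → L → L → L) (φ : L [⋀^Fin k]→ₗ[S] L) (ψ : L [⋀^Fin l]→ₗ[S] L)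
    (w : Fin (k + l + 1) → L) : L :=
  R (φ fun i => w (Fin.castAdd l i).castSucc) (ψ fun j => w (Fin.natAdd k j).castSucc)
    (w (Fin.last (k + l)))

theorem curvBase_last (v : Fin (k + l + 1) → L) (x : L) :
    curvBase R φ ψ (Function.update v (Fin.last (k + l)) x)
      = R (φ fun i => v (Fin.castAdd l i).castSucc) (ψ fun j => v (Fin.natAdd k j).castSucc)
        x := by
  have h : ∀ a : Fin (k + l), Function.update v (Fin.last (k + l)) x a.castSucc = v a.castSucc :=
    fun a => Function.update_of_ne (Fin.castSucc_lt_last a).ne _ _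
  simp only [curvBase, h, Function.update_self]

theorem curvBase_castAdd (v : Fin (k + l + 1) → L) (i : Fin k) (x : L) :
    curvBase R φ ψ (Function.update v (Fin.castAdd l i).castSucc x)
      = R (φ (Function.update (fun i => v (Fin.castAdd l i).castSucc) i x))
        (ψ fun j => v (Fin.natAdd k j).castSucc) (v (Fin.last (k + l))) := by
  have h := update_castSucc v (Fin.castAdd l i) x
  have h1 : ∀ a : Fin (k + l), Function.update v (Fin.castAdd l i).castSucc x a.castSucc
      = Function.update (fun a : Fin (k + l) => v a.castSucc) (Fin.castAdd l i) x a :=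
    fun a => congrFun h.1 a
  simp only [curvBase, h.2, h1]
  have h2 := update_castAdd (fun a => v a.castSucc) i x
  rw [h2.1, h2.2]

theorem curvBase_natAdd (v : Fin (k + l + 1) → L) (i : Fin l) (x : L) :
    curvBase R φ ψ (Function.update v (Fin.natAdd k i).castSucc x)
      = R (φ fun i => v (Fin.castAdd l i).castSucc)
        (ψ (Function.update (fun j => v (Fin.natAdd k j).castSucc) i x))
        (v (Fin.last (k + l))) := by
  have h := update_castSucc v (Fin.natAdd k i) x
  have h1 : ∀ a : Fin (k + l), Function.update v (Fin.natAdd k i).castSucc x a.castSucc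
      = Function.update (fun a : Fin (k + l) => v a.castSucc) (Fin.natAdd k i) x a :=
    fun a => congrFun h.1 a
  simp only [curvBase, h.2, h1]
  have h2 := update_natAdd (fun a => v a.castSucc) i x
  rw [h2.1, h2.2]

theorem curvBase_add
    (R_add₁ : ∀ x y z w, R (x + y) z w = R x z w + R y z w)
    (R_add₂ : ∀ x y z w, R x (y + z) w = R x y w + R x z w)
    (R_add₃ : ∀ x y z w, R x y (z + w) = R x y z + R x y w)
    : SlotAdd (curvBase R φ ψ) := by
  intro v i x y
  refine Fin.lastCases ?_ (fun i => ?_) i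
  · simp only [curvBase_last, R_add₃]
  · refine Fin.addCases (fun i => ?_) (fun i => ?_) i
    · simp only [curvBase_castAdd, φ.map_update_add, R_add₁]
    · simp only [curvBase_natAdd, ψ.map_update_add, R_add₂]

theorem curvBase_smul
    (R_smul₁ : ∀ (c : S) x y z, R (c • x) y z = c • R x y z)
    (R_smul₂ : ∀ (c : S) x y z, R x (c • y) z = c • R x y z)
    (R_smul₃ : ∀ (c : S) x y z, R x y (c • z) = c • R x y z)
    (v : Fin (k + l + 1) → L) (i : Fin (k + l + 1)) (c : S) (x : L) :
    curvBase R φ ψ (Function.update v i (c • x))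
      = c • curvBase R φ ψ (Function.update v i x) := by
  refine Fin.lastCases ?_ (fun i => ?_) i
  · simp only [curvBase_last, R_smul₃]
  · refine Fin.addCases (fun i => ?_) (fun i => ?_) i
    · simp only [curvBase_castAdd, φ.map_update_smul, R_smul₁]
    · simp only [curvBase_natAdd, ψ.map_update_smul, R_smul₂]

theorem curvFun_adj
    (R_smul₁ : ∀ (c : S) x y z, R (c • x) y z = c • R x y z)
    (R_smul₂ : ∀ (c : S) x y z, R x (c • y) z = c • R x y z)
    : AdjZero (curvFun R (k := k) (l := l) φ ψ) := by
  intro v t t' htt hv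
  refine shuffle_sum_adj (fun i j : Fin (k + l + 1) =>
      (j : ℕ) < k ∨ (k ≤ (i : ℕ) ∧ (j : ℕ) < k + l) ∨ k + l ≤ (i : ℕ))
    (curvBase R φ ψ) ?_ v t t' htt hv
  intro w i j hij hs hw
  have hij' : (i : ℕ) < j := hij
  rcases hs with hs | hs | hs
  · have h0 : (φ fun i => w (Fin.castAdd l i).castSucc) = 0 :=
      φ.map_eq_zero_of_eq _ (i := ⟨i, by omega⟩) (j := ⟨j, hs⟩) hw (by simp [Fin.ext_iff]; omega)
    rw [curvBase, h0]
    simpa using R_smul₁ 0 0 (ψ fun j => w (Fin.natAdd k j).castSucc) (w (Fin.last (k + l)))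
  · have h0 : (ψ fun j => w (Fin.natAdd k j).castSucc) = 0 := by
      refine ψ.map_eq_zero_of_eq _ (i := ⟨i - k, by omega⟩) (j := ⟨j - k, by omega⟩) ?_
        (by simp [Fin.ext_iff]; omega)
      convert hw using 2 <;> (simp [Fin.ext_iff]; omega)
    rw [curvBase, h0]
    simpa using R_smul₂ 0 (φ fun i => w (Fin.castAdd l i).castSucc) 0 (w (Fin.last (k + l)))
  · have := j.2
    omega

end Curv

end Helpers

/-! ### Lie algebroids over a manifold, connections, forms -/

section Geometry

variable {EM : Type*} [NormedAddCommGroup EM] [NormedSpace ℝ EM]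
  {H : Type*} [TopologicalSpace H] {I : ModelWithCorners ℝ EM H}
  {M : Type*} [TopologicalSpace M] [ChartedSpace H M]
  {F : Type*} [NormedAddCommGroup F] [NormedSpace ℝ F]
  {A : M → Type*} [TopologicalSpace (TotalSpace F A)] [∀ x, AddCommGroup (A x)]
  [∀ x, Module ℝ (A x)] [∀ x, TopologicalSpace (A x)] [FiberBundle F A] [VectorBundle ℝ F A]

/-- Multiplication of a smooth section by a smooth function. -/
instance instSMulSection : SMul C^∞⟮I, M; ℝ⟯ Cₛ^∞⟮I; F, A⟯ where
  smul f s := ⟨fun x => f x • s x, f.contMDiff.smul_section s.contMDiff⟩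

@[simp]
theorem smul_section_apply (f : C^∞⟮I, M; ℝ⟯) (s : Cₛ^∞⟮I; F, A⟯) (x : M) :
    (f • s) x = f x • s x := rfl

/-- `Γ(A)` is a module over `C^∞(M)`. -/
instance instModuleSection : Module C^∞⟮I, M; ℝ⟯ Cₛ^∞⟮I; F, A⟯ where
  one_smul s := by ext x; simp
  mul_smul f g s := by ext x; simp [mul_smul]
  smul_zero f := by ext x; simp
  smul_add f s t := by ext x; simp
  add_smul f g s := by ext x; simp [add_smul]
  zero_smul s := by ext x; simp

instance instSMulCommSection : SMulCommClass C^∞⟮I, M; ℝ⟯ ℝ Cₛ^∞⟮I; F, A⟯ where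
  smul_comm f c s := by ext x; exact smul_comm (f x) c (s x)

instance instTowerSection : IsScalarTower ℝ C^∞⟮I, M; ℝ⟯ Cₛ^∞⟮I; F, A⟯ where
  smul_assoc c f s := by ext x; exact smul_assoc c (f x) (s x)


variable (I F A) in
/-- An anchor: a smooth bundle map `ρ : A → TM` over the identity of `M`. -/
structure Anchor [IsManifold I ∞ M] where
  /-- the fibrewise linear maps `ρ_x : A_x → T_x M` -/
  anchor : ∀ x : M, A x →ₗ[ℝ] TangentSpace I x
  contMDiff_anchor : ContMDiff (I.prod 𝓘(ℝ, F)) I.tangent ∞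
    fun v : TotalSpace F A => (⟨v.proj, anchor v.proj v.snd⟩ : TangentBundle I M)

/-- The function `ρ(X) f`, that is `x ↦ df_x (ρ_x (X x))`. -/
def Anchor.deriv [IsManifold I ∞ M] (ρ : Anchor I F A) (X : Cₛ^∞⟮I; F, A⟯)
    (f : C^∞⟮I, M; ℝ⟯) : C^∞⟮I, M; ℝ⟯ :=
  ⟨fun x => mfderiv I 𝓘(ℝ, ℝ) f x (ρ.anchor x (X x)), by
    have h1 : ContMDiff I I.tangent ∞
        fun x => (⟨x, ρ.anchor x (X x)⟩ : TangentBundle I M) :=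
      ρ.contMDiff_anchor.comp X.contMDiff
    have h2 := (f.contMDiff.contMDiff_tangentMap (m := ∞) (by simp)).comp h1
    exact (contMDiff_snd_tangentBundle_modelSpace ℝ 𝓘(ℝ, ℝ)).comp h2⟩

variable (I F A) in
/-- A Lie algebroid structure on the vector bundle `A → M`: an anchor and a Lie bracket on the
smooth sections which satisfies the Leibniz rule. (That the anchor preserves brackets is a
consequence.) -/
structure LieAlgebroid [IsManifold I ∞ M] extends Anchor I F A where
  /-- the bracket of sections -/
  bracket : Cₛ^∞⟮I; F, A⟯ → Cₛ^∞⟮I; F, A⟯ → Cₛ^∞⟮I; F, A⟯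
  bracket_add : ∀ X Y Z, bracket X (Y + Z) = bracket X Y + bracket X Z
  bracket_smul : ∀ (c : ℝ) X Y, bracket X (c • Y) = c • bracket X Y
  bracket_skew : ∀ X Y, bracket X Y = -bracket Y X
  jacobi : ∀ X Y Z,
    bracket X (bracket Y Z) + bracket Y (bracket Z X) + bracket Z (bracket X Y) = 0
  leibniz : ∀ X (f : C^∞⟮I, M; ℝ⟯) Y,
    bracket X (f • Y) = f • bracket X Y + toAnchor.deriv X f • Y

variable [IsManifold I ∞ M]
  {FE : Type*} [NormedAddCommGroup FE] [NormedSpace ℝ FE]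
  {E : M → Type*} [TopologicalSpace (TotalSpace FE E)] [∀ x, AddCommGroup (E x)]
  [∀ x, Module ℝ (E x)] [∀ x, TopologicalSpace (E x)] [FiberBundle FE E] [VectorBundle ℝ FE E]

section Bracket

variable (𝒜 : LieAlgebroid I F A)

theorem LieAlgebroid.bracket_self (X : Cₛ^∞⟮I; F, A⟯) : 𝒜.bracket X X = 0 := by
  have h := 𝒜.bracket_skew X X
  have h2 : (2 : ℝ) • 𝒜.bracket X X = 0 := by
    rw [two_smul]; nth_rewrite 1 [h]; exact neg_add_cancel _
  exact (smul_eq_zero_iff_right (two_ne_zero' ℝ)).mp h2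

theorem LieAlgebroid.add_bracket (X Y Z : Cₛ^∞⟮I; F, A⟯) :
    𝒜.bracket (X + Y) Z = 𝒜.bracket X Z + 𝒜.bracket Y Z := by
  rw [𝒜.bracket_skew, 𝒜.bracket_add, 𝒜.bracket_skew Z X, 𝒜.bracket_skew Z Y]
  abel

theorem LieAlgebroid.smul_bracket (f : C^∞⟮I, M; ℝ⟯) (X Y : Cₛ^∞⟮I; F, A⟯) :
    𝒜.bracket (f • X) Y = f • 𝒜.bracket X Y - 𝒜.deriv Y f • X := by
  rw [𝒜.bracket_skew, 𝒜.leibniz, 𝒜.bracket_skew Y X, smul_neg]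
  abel

/-- The anchor preserves brackets, tested on `f • Z`. -/
theorem LieAlgebroid.deriv_bracket_smul (X Y Z : Cₛ^∞⟮I; F, A⟯) (f : C^∞⟮I, M; ℝ⟯) :
    𝒜.deriv (𝒜.bracket X Y) f • Z
      = 𝒜.deriv X (𝒜.deriv Y f) • Z - 𝒜.deriv Y (𝒜.deriv X f) • Z := by
  have J : ∀ W, 𝒜.bracket (𝒜.bracket X Y) W
      = 𝒜.bracket X (𝒜.bracket Y W) - 𝒜.bracket Y (𝒜.bracket X W) := by
    intro W
    have h := 𝒜.jacobi X Y W
    have hn : ∀ U V, 𝒜.bracket U (-V) = -𝒜.bracket U V := by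
      intro U V
      have := 𝒜.bracket_smul (-1) U V
      simpa using this
    rw [𝒜.bracket_skew W X, hn, 𝒜.bracket_skew W] at h
    rw [← sub_eq_zero, ← neg_eq_zero, ← h]
    abel
  have h := J (f • Z)
  simp only [𝒜.leibniz, 𝒜.bracket_add, J Z, smul_sub] at h
  have h' := sub_eq_zero.mpr h
  rw [← sub_eq_zero, ← h']
  abel

end Bracket

variable (FE E) in
/-- An `A`-connection on the vector bundle `E → M`. -/
structure Connection (𝒜 : LieAlgebroid I F A) where
  /-- the section `∇_X s` -/
  cov : Cₛ^∞⟮I; F, A⟯ → Cₛ^∞⟮I; FE, E⟯ → Cₛ^∞⟮I; FE, E⟯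
  cov_add : ∀ X s t, cov X (s + t) = cov X s + cov X t
  cov_smul : ∀ X (c : ℝ) s, cov X (c • s) = c • cov X s
  add_cov : ∀ X Y s, cov (X + Y) s = cov X s + cov Y s
  smul_cov : ∀ (f : C^∞⟮I, M; ℝ⟯) X s, cov (f • X) s = f • cov X s
  leibniz : ∀ X (f : C^∞⟮I, M; ℝ⟯) s, cov X (f • s) = 𝒜.deriv X f • s + f • cov X s

namespace Connection

variable {𝒜 : LieAlgebroid I F A}

/-- The curvature `R(X,Y)s = ∇_X ∇_Y s - ∇_Y ∇_X s - ∇_[X,Y] s`. -/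
def curvature (D : Connection FE E 𝒜) (X Y : Cₛ^∞⟮I; F, A⟯) (s : Cₛ^∞⟮I; FE, E⟯) :
    Cₛ^∞⟮I; FE, E⟯ :=
  D.cov X (D.cov Y s) - D.cov Y (D.cov X s) - D.cov (𝒜.bracket X Y) s

/-- A connection is flat (a representation of the Lie algebroid) if its curvature vanishes. -/
def IsFlat (D : Connection FE E 𝒜) : Prop := ∀ X Y s, D.curvature X Y s = 0

/-- An `A`-connection on `A` is torsion-free if `∇_X Y - ∇_Y X = [X,Y]`. -/
def IsTorsionFree (D : Connection F A 𝒜) : Prop :=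
  ∀ X Y, D.cov X Y - D.cov Y X = 𝒜.bracket X Y

theorem cov_sub (D : Connection FE E 𝒜) (X : Cₛ^∞⟮I; F, A⟯) (s t : Cₛ^∞⟮I; FE, E⟯) :
    D.cov X (s - t) = D.cov X s - D.cov X t := by
  have := D.cov_smul X (-1) t
  rw [sub_eq_add_neg, D.cov_add, sub_eq_add_neg]
  simpa using this

theorem sub_cov (D : Connection FE E 𝒜) (X Y : Cₛ^∞⟮I; F, A⟯) (s : Cₛ^∞⟮I; FE, E⟯) :
    D.cov (X - Y) s = D.cov X s - D.cov Y s := by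
  have := D.smul_cov (-1) Y s
  rw [sub_eq_add_neg, D.add_cov, sub_eq_add_neg]
  simpa using this

theorem curvature_skew (D : Connection FE E 𝒜) (X Y : Cₛ^∞⟮I; F, A⟯) (s : Cₛ^∞⟮I; FE, E⟯) :
    D.curvature X Y s = -D.curvature Y X s := by
  have h : D.cov (-𝒜.bracket Y X) s = -D.cov (𝒜.bracket Y X) s := by
    have := D.smul_cov (-1) (𝒜.bracket Y X) s
    simpa using this
  rw [curvature, curvature, 𝒜.bracket_skew X Y, h]
  abel

theorem curvature_add₁ (D : Connection FE E 𝒜) (X Y Z : Cₛ^∞⟮I; F, A⟯)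
    (s : Cₛ^∞⟮I; FE, E⟯) :
    D.curvature (X + Y) Z s = D.curvature X Z s + D.curvature Y Z s := by
  simp only [curvature, D.add_cov, D.cov_add, 𝒜.add_bracket]
  abel

theorem curvature_add₂ (D : Connection FE E 𝒜) (X Y Z : Cₛ^∞⟮I; F, A⟯)
    (s : Cₛ^∞⟮I; FE, E⟯) :
    D.curvature X (Y + Z) s = D.curvature X Y s + D.curvature X Z s := by
  simp only [curvature, D.add_cov, D.cov_add, 𝒜.bracket_add]
  abel

theorem curvature_add₃ (D : Connection FE E 𝒜) (X Y : Cₛ^∞⟮I; F, A⟯)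
    (s t : Cₛ^∞⟮I; FE, E⟯) :
    D.curvature X Y (s + t) = D.curvature X Y s + D.curvature X Y t := by
  simp only [curvature, D.cov_add]
  abel

theorem curvature_smul₁ (D : Connection FE E 𝒜) (f : C^∞⟮I, M; ℝ⟯) (X Y : Cₛ^∞⟮I; F, A⟯)
    (s : Cₛ^∞⟮I; FE, E⟯) : D.curvature (f • X) Y s = f • D.curvature X Y s := by
  simp only [curvature, D.smul_cov, D.leibniz, 𝒜.smul_bracket, D.sub_cov, smul_sub]
  abel

theorem curvature_smul₂ (D : Connection FE E 𝒜) (f : C^∞⟮I, M; ℝ⟯) (X Y : Cₛ^∞⟮I; F, A⟯)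
    (s : Cₛ^∞⟮I; FE, E⟯) : D.curvature X (f • Y) s = f • D.curvature X Y s := by
  rw [D.curvature_skew, D.curvature_smul₁, D.curvature_skew Y X, smul_neg, neg_neg]

theorem curvature_smul₃ (D : Connection F A 𝒜) (f : C^∞⟮I, M; ℝ⟯)
    (X Y Z : Cₛ^∞⟮I; F, A⟯) : D.curvature X Y (f • Z) = f • D.curvature X Y Z := by
  simp only [curvature, D.leibniz, D.cov_add, smul_sub, 𝒜.deriv_bracket_smul]
  abel

end Connection

variable (I F A FE E) in
/-- `Ω^k(A,E)`: the skew-symmetric `C^∞(M)`-multilinear maps `Γ(A)^k → Γ(E)`. -/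
abbrev Form (k : ℕ) :=
  Cₛ^∞⟮I; F, A⟯ [⋀^Fin k]→ₗ[C^∞⟮I, M; ℝ⟯] Cₛ^∞⟮I; FE, E⟯

variable (I F A FE E) in
/-- `Ω^*(A,E)`, the direct sum of the spaces `Ω^k(A,E)`. -/
abbrev Forms := DirectSum ℕ fun k => Form I F A FE E k

/-- Shortcut instance. -/
instance instAddCommGroupForms : AddCommGroup (Forms I F A FE E) := inferInstance

/-- Shortcut instance. -/
instance instModuleForms : Module ℝ (Forms I F A FE E) := inferInstance

/-- Shortcut instance. -/
instance instAddCommGroupEnd : AddCommGroup (Module.End ℝ (Forms I F A FE E)) := inferInstance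

/-- Shortcut instance. -/
instance instModuleEnd : Module ℝ (Module.End ℝ (Forms I F A FE E)) := inferInstance

/-- A `k`-form as an element of `Ω^*(A,E)`. -/
def homog (k : ℕ) : Form I F A FE E k →ₗ[ℝ] Forms I F A FE E :=
  DirectSum.lof ℝ ℕ (fun k => Form I F A FE E k) k

theorem real_smul_section (c : ℝ) (s : Cₛ^∞⟮I; F, A⟯) :
    c • s = (algebraMap ℝ C^∞⟮I, M; ℝ⟯ c) • s := (algebraMap_smul _ c s).symm

/-- `i_φ` for `φ ∈ Ω^k(A,A)`, from `Ω^{m+1}(A,E)` to `Ω^{k+m}(A,E)`; linear in `φ`. -/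
def insertHom (k m : ℕ) :
    Form I F A F A k →ₗ[ℝ] Form I F A FE E (m + 1) →ₗ[ℝ] Form I F A FE E (k + m) :=
  LinearMap.mk₂ ℝ (fun φ ψ => insertForm φ ψ)
    (by
      intro φ φ' ψ; ext1 v
      simp only [AlternatingMap.add_apply, insertForm_apply, insertFun, cons_add, smul_add,
        Finset.sum_add_distrib])
    (by
      intro c φ ψ; ext1 v
      simp only [AlternatingMap.smul_apply, insertForm_apply, insertFun, Finset.smul_sum]
      refine Finset.sum_congr rfl fun σ _ => ?_
      rw [real_smul_section, cons_smul, ← real_smul_section]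
      simp only [Units.smul_def]
      exact smul_comm _ _ _)
    (by
      intro φ ψ ψ'; ext1 v
      simp only [AlternatingMap.add_apply, insertForm_apply, insertFun, smul_add,
        Finset.sum_add_distrib])
    (by
      intro c φ ψ; ext1 v
      simp only [AlternatingMap.smul_apply, insertForm_apply, insertFun, Finset.smul_sum,
        Units.smul_def]
      exact Finset.sum_congr rfl fun σ _ => smul_comm _ _ _)

variable {𝒜 : LieAlgebroid I F A}

/-- The covariant exterior derivative of a form. -/
def extDerivForm (D : Connection FE E 𝒜) {p : ℕ} (η : Form I F A FE E p) :
    Form I F A FE E (p + 1) :=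
  mkAlt (extDerivFun D.cov 𝒜.bracket η)
    (extDerivFun_add D.add_cov D.cov_add 𝒜.add_bracket 𝒜.bracket_add η)
    (extDerivFun_smul (a := 𝒜.deriv) D.add_cov D.cov_add D.smul_cov
      (fun X f s => (D.leibniz X f s).trans (add_comm _ _)) 𝒜.add_bracket 𝒜.bracket_add
      𝒜.bracket_self 𝒜.smul_bracket η)
    (extDerivFun_adj D.cov_add 𝒜.bracket_self η)

theorem extDerivForm_apply (D : Connection FE E 𝒜) {p : ℕ} (η : Form I F A FE E p)
    (Z : Fin (p + 1) → Cₛ^∞⟮I; F, A⟯) :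
    extDerivForm D η Z = extDerivFun D.cov 𝒜.bracket η Z := rfl

theorem bracketSum_linear (br : Cₛ^∞⟮I; F, A⟯ → Cₛ^∞⟮I; F, A⟯ → Cₛ^∞⟮I; F, A⟯) :
    ∀ {p : ℕ} (c : ℝ) (η θ : Form I F A FE E p) (Z : Fin (p + 1) → Cₛ^∞⟮I; F, A⟯),
      bracketSum br (⇑(c • η + θ)) Z = c • bracketSum br η Z + bracketSum br θ Z
  | 0, _, _, _, _ => by simp [bracketSum]
  | q + 1, c, η, θ, Z => by
    simp only [bracketSum, AlternatingMap.add_apply, AlternatingMap.smul_apply, smul_add,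
      Finset.sum_add_distrib, Finset.smul_sum, Units.smul_def]
    congr 1
    exact Finset.sum_congr rfl fun σ _ => smul_comm _ _ _

theorem extDerivForm_linear (D : Connection FE E 𝒜) {p : ℕ} (c : ℝ)
    (η θ : Form I F A FE E p) :
    extDerivForm D (c • η + θ) = c • extDerivForm D η + extDerivForm D θ := by
  ext1 v
  simp only [AlternatingMap.add_apply, AlternatingMap.smul_apply, extDerivForm_apply]
  simp only [extDerivFun, bracketSum_linear]
  simp only [AlternatingMap.add_apply, AlternatingMap.smul_apply, D.cov_add, D.cov_smul,
    smul_add, Finset.sum_add_distrib, smul_sub, Finset.smul_sum, Units.smul_def]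
  rw [Finset.sum_congr rfl fun σ _ => smul_comm _ c _]
  abel

/-- The covariant exterior derivative `d^∇` from `Ω^p(A,E)` to `Ω^{p+1}(A,E)`. -/
def extDerivHom (D : Connection FE E 𝒜) (p : ℕ) :
    Form I F A FE E p →ₗ[ℝ] Form I F A FE E (p + 1) where
  toFun η := extDerivForm D η
  map_add' η θ := by simpa using extDerivForm_linear D 1 η θ
  map_smul' c η := by
    have h0 : extDerivForm D (0 : Form I F A FE E p) = 0 := by
      simpa using extDerivForm_linear D (-1) 0 (0 : Form I F A FE E p)
    simpa [h0] using extDerivForm_linear D c η 0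

/-- The form `R(φ,ψ) ∈ Ω^{k+l+1}(A,A)` built from the curvature of an `A`-connection on `A`. -/
def curvForm (D : Connection F A 𝒜) {k l : ℕ} (φ : Form I F A F A k) (ψ : Form I F A F A l) :
    Form I F A F A (k + l + 1) :=
  mkAlt (curvFun D.curvature φ ψ)
    ((curvBase_add φ ψ D.curvature_add₁ D.curvature_add₂ D.curvature_add₃).shuffle _)
    (slotSmul_shuffle (G := curvBase D.curvature φ ψ)
      (curvBase_smul φ ψ D.curvature_smul₁ D.curvature_smul₂ D.curvature_smul₃)
      (shuffles₃ k l (k + l + 1)))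
    (curvFun_adj φ ψ D.curvature_smul₁ D.curvature_smul₂)

theorem curvForm_apply (D : Connection F A 𝒜) {k l : ℕ} (φ : Form I F A F A k)
    (ψ : Form I F A F A l) (Y : Fin (k + l + 1) → Cₛ^∞⟮I; F, A⟯) :
    curvForm D φ ψ Y = curvFun D.curvature φ ψ Y := rfl

/-! ### The operators on `Ω^*(A,E)` -/

/-- `i_φ` on homogeneous forms: zero on `Ω^0(A,E)`. -/
def insertOn (k : ℕ) :
    (m : ℕ) → Form I F A F A k →ₗ[ℝ] Form I F A FE E m →ₗ[ℝ] Forms I F A FE E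
  | 0 => 0
  | m + 1 => (insertHom k m).compr₂ (homog (k + m))

/-- `i_φ` for `φ ∈ Ω^k(A,A)`, as an endomorphism of `Ω^*(A,E)`; linear in `φ`. -/
def interior (k : ℕ) : Form I F A F A k →ₗ[ℝ] Module.End ℝ (Forms I F A FE E) where
  toFun φ := DirectSum.toModule ℝ ℕ _ fun m => insertOn k m φ
  map_add' φ φ' := by
    refine DirectSum.linearMap_ext ℝ fun m => ?_
    ext1 η
    simp
  map_smul' c φ := by
    refine DirectSum.linearMap_ext ℝ fun m => ?_
    ext1 η
    simp

/-- The covariant exterior derivative `d^∇` as an endomorphism of `Ω^*(A,E)`. -/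
def extDeriv (D : Connection FE E 𝒜) : Module.End ℝ (Forms I F A FE E) :=
  DirectSum.toModule ℝ ℕ _ fun p => homog (p + 1) ∘ₗ extDerivHom D p

/-- The covariant Lie derivative `𝓛^∇_φ = i_φ d^∇ + (-1)^k d^∇ i_φ` for `φ ∈ Ω^k(A,A)`. -/
def lieDeriv (D : Connection FE E 𝒜) (k : ℕ) :
    Form I F A F A k →ₗ[ℝ] Module.End ℝ (Forms I F A FE E) where
  toFun φ := interior k φ * extDeriv D + (-1 : ℝ) ^ k • (extDeriv D * interior k φ)
  map_add' φ φ' := by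
    simp only [map_add, add_mul, mul_add, smul_add]; abel
  map_smul' c φ := by
    simp only [map_smul, smul_mul_assoc, mul_smul_comm, smul_add, RingHom.id_apply]
    rw [smul_comm c]

/-- `∇_φ = 𝓛^∇_φ - (-1)^k i_{d^∇ φ}` on `Ω^*(A,E)` for `φ ∈ Ω^k(A,A)`, where `D` is the connection
on `E` (used in `𝓛^∇_φ`) and `DA` the connection on `A` (used in `d^∇ φ`); linear in `φ`. -/
def nablaHom (DA : Connection F A 𝒜) (D : Connection FE E 𝒜) (k : ℕ) :
    Form I F A F A k →ₗ[ℝ] Module.End ℝ (Forms I F A FE E) where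
  toFun φ := lieDeriv D k φ - (-1 : ℝ) ^ k • interior (k + 1) (extDerivHom DA k φ)
  map_add' φ φ' := by
    simp only [map_add, smul_add]; abel
  map_smul' c φ := by
    simp only [map_smul, RingHom.id_apply, smul_sub]
    rw [smul_comm c]

/-- `Φ ↦ ∇_Φ`, extended linearly to all `Φ ∈ Ω^*(A,A)`. -/
def nabla (DA : Connection F A 𝒜) (D : Connection FE E 𝒜) :
    Forms I F A F A →ₗ[ℝ] Module.End ℝ (Forms I F A FE E) :=
  DirectSum.toModule ℝ ℕ _ (nablaHom DA D)

/-- The graded commutator of operators of degrees `k` and `l`. -/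
def gradedCommutator {W : Type*} [AddCommGroup W] [Module ℝ W] (k l : ℕ)
    (P Q : Module.End ℝ W) : Module.End ℝ W :=
  P * Q - (-1 : ℝ) ^ (k * l) • (Q * P)

end Geometry
end LieAlgd
end

/-! A form is determined by its value on the empty list of sections and by its contractions `i_Z`
with sections `Z`. The operators `i_φ`, `d^∇` and `∇_φ` obey recursions under contraction. When the
connection on `A` is torsion-free, the one for `∇_φ` with `φ` of degree `k`,

`i_Z ∇_φ = ∇_{i_Z φ} + (-1)^k ∇_φ i_Z - (-1)^k i_χ` with `χ(Y₁, …, Yₖ) = ∇_{φ(Y₁, …, Yₖ)} Z`,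

involves no derivative of `φ`. Hence the commutators `[i_φ, i_ψ]`, `[∇_φ, i_ψ]` and `[∇_φ, ∇_ψ]`
can be computed, in this order, by induction on the number of arguments. Flatness enters only when
there are no arguments, and the curvature term measures the failure of `∇_φ` to commute with
`ψ ↦ ∇_ψ Z`. Sums over shuffles obey the same recursions: single out the block which contains the
first argument.
-/

noncomputable section

namespace LieAlgd

section Signs

/-- The Koszul sign `(-1) ^ (p * q)` as a function of `(-1) ^ p` and `(-1) ^ q`. -/
def koszulSign (ε δ : ℤˣ) : ℤˣ := if ε = -1 ∧ δ = -1 then -1 else 1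

theorem koszulSign_neg_one_pow (p q : ℕ) :
    koszulSign ((-1) ^ p) ((-1) ^ q) = (-1) ^ (p * q) := by
  rw [pow_mul]
  rcases neg_one_pow_eq_or ℤˣ p with hp | hp <;> rcases neg_one_pow_eq_or ℤˣ q with hq | hq <;>
    simp [koszulSign, hp, hq]

theorem koszulSign_one_left (δ : ℤˣ) : koszulSign 1 δ = 1 :=
  if_neg fun h => absurd h.1 (by decide)

theorem koszulSign_one_right (ε : ℤˣ) : koszulSign ε 1 = 1 :=
  if_neg fun h => absurd h.2 (by decide)

theorem koszulSign_neg_one : koszulSign (-1) (-1) = -1 := rfl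

end Signs

section Operators

variable {L N : Type*} [AddCommGroup N]

/-- The contraction of a function on lists with `Z`, which fixes its first argument to be `Z`. -/
def contr (Z : L) : (List L → N) →+ List L → N where
  toFun f l := f (Z :: l)
  map_zero' := rfl
  map_add' _ _ := rfl

theorem contr_apply (Z : L) (f : List L → N) (l : List L) : contr Z f l = f (Z :: l) := rfl

/-- Antisymmetry in any two consecutive arguments, for lists of every length. -/
def IsSkew (f : List L → N) : Prop :=
  ∀ l x y m, f (l ++ y :: x :: m) = -f (l ++ x :: y :: m)

theorem IsSkew.contr {f : List L → N} (hf : IsSkew f) (Z : L) : IsSkew (contr Z f) :=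
  fun l => hf (Z :: l)

/-- A function on lists has sign `ε` if it vanishes on the lists of length `n` whenever
`(-1) ^ n ≠ ε`, so that a form of degree `k` has sign `(-1) ^ k`. -/
def HasSign (ε : ℤˣ) (f : List L → N) : Prop :=
  ∀ l, (-1) ^ l.length ≠ ε → f l = 0

theorem HasSign.contr {ε : ℤˣ} {f : List L → N} (hf : HasSign ε f) (Z : L) :
    HasSign (-ε) (contr Z f) := fun l hl =>
  hf (Z :: l) fun h => hl (by rw [← h, List.length_cons, pow_succ, mul_neg_one, neg_neg])

theorem HasSign.eq_one_or_nil_eq_zero {ε : ℤˣ} {f : List L → N} (hf : HasSign ε f) :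
    ε = 1 ∨ f [] = 0 :=
  or_iff_not_imp_left.2 fun h => hf [] (Ne.symm h)

theorem HasSign.neg_one_pow_smul_comp {N' : Type*} [AddCommGroup N'] {ε : ℤˣ} {f : List L → N}
    (hf : HasSign ε f) {g : N → N'} (hg : g 0 = 0) (l : List L) :
    (-1 : ℤˣ) ^ l.length • g (f l) = ε • g (f l) := by
  by_cases h : (-1) ^ l.length = ε
  · rw [h]
  · rw [hf l h, hg, smul_zero, smul_zero]

variable [AddCommGroup L]

/-- Additivity in each argument, for lists of every length. -/
def IsMultiadditive (f : List L → N) : Prop :=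
  ∀ l x y m, f (l ++ (x + y) :: m) = f (l ++ x :: m) + f (l ++ y :: m)

theorem IsMultiadditive.contr {f : List L → N} (hf : IsMultiadditive f) (Z : L) :
    IsMultiadditive (contr Z f) :=
  fun l => hf (Z :: l)

theorem IsMultiadditive.zero_cons {f : List L → N} (hf : IsMultiadditive f) (l : List L) :
    f (0 :: l) = 0 := by
  simpa using hf [] 0 0 l

theorem IsMultiadditive.sub_cons {f : List L → N} (hf : IsMultiadditive f) (x y : L) (l : List L) :
    f ((x - y) :: l) = f (x :: l) - f (y :: l) :=
  map_sub (AddMonoidHom.mk' (fun z => f (z :: l)) fun x y => hf [] x y l) x y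

end Operators

section Insertion

variable {L N : Type*} [AddCommGroup L] [AddCommGroup N]

/-- The values of the operator `listInsert` on a given list. -/
def listInsertAt : List L → ℤˣ → (List L → L) → (List L → N) →+ N
  | [], _, φ => Pi.evalAddMonoidHom _ [φ []]
  | Z :: l, ε, φ => listInsertAt l (-ε) (contr Z φ) - ε • (listInsertAt l ε φ).comp (contr Z)

/-- The operator `i_φ` on functions on lists, for `φ` of sign `ε`. -/
def listInsert (ε : ℤˣ) (φ : List L → L) : (List L → N) →+ List L → N :=
  AddMonoidHom.pi fun l => listInsertAt l ε φ

theorem listInsert_nil (ε : ℤˣ) (φ : List L → L) (f : List L → N) :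
    listInsert ε φ f [] = f [φ []] := rfl

theorem contr_listInsert (ε : ℤˣ) (φ : List L → L) (f : List L → N) (Z : L) :
    contr Z (listInsert ε φ f)
      = listInsert (-ε) (contr Z φ) f - ε • listInsert ε φ (contr Z f) := rfl

theorem listInsert_cons (ε : ℤˣ) (φ : List L → L) (f : List L → N) (Z : L) (l : List L) :
    listInsert ε φ f (Z :: l)
      = listInsert (-ε) (contr Z φ) f l - ε • listInsert ε φ (contr Z f) l := rfl

theorem listInsert_add_left (ε : ℤˣ) (φ ψ : List L → L) {f : List L → N} (hf : IsMultiadditive f) :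
    listInsert ε (φ + ψ) f = listInsert ε φ f + listInsert ε ψ f := by
  funext l
  induction l generalizing ε φ ψ f with
  | nil => exact hf [] (φ []) (ψ []) []
  | cons Z l ih =>
    simp only [Pi.add_apply, listInsert_cons, map_add, ih _ _ _ hf, ih _ _ _ (hf.contr Z),
      smul_add]
    abel

theorem listInsert_sub_left (ε : ℤˣ) (φ ψ : List L → L) {f : List L → N} (hf : IsMultiadditive f) :
    listInsert ε (φ - ψ) f = listInsert ε φ f - listInsert ε ψ f :=
  map_sub (AddMonoidHom.mk' (fun φ => listInsert ε φ f)
    fun φ ψ => listInsert_add_left ε φ ψ hf) φ ψ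

theorem listInsert_neg_left (ε : ℤˣ) (φ : List L → L) {f : List L → N} (hf : IsMultiadditive f) :
    listInsert ε (-φ) f = -listInsert ε φ f :=
  map_neg (AddMonoidHom.mk' (fun φ => listInsert ε φ f)
    fun φ ψ => listInsert_add_left ε φ ψ hf) φ

theorem listInsert_listInsert {ε δ : ℤˣ} {φ ψ : List L → L} (hφ : HasSign ε φ)
    (hψ : HasSign δ ψ) {f : List L → N} (hf : IsMultiadditive f) (hs : IsSkew f) :
    listInsert ε φ (listInsert δ ψ f)
        - koszulSign (-ε) (-δ) • listInsert δ ψ (listInsert ε φ f)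
      = listInsert (-(ε * δ)) (listInsert ε φ ψ) f
        - koszulSign (-ε) (-δ) • listInsert (-(ε * δ)) (listInsert δ ψ φ) f := by
  funext l
  induction l generalizing ε δ φ ψ f with
  | nil =>
    have hswap : ∀ x y, f [y, x] = -f [x, y] := fun x y => hs [] x y []
    have hzero : ∀ Z, f [Z, 0] = 0 := fun Z => (hf.contr Z).zero_cons []
    simp only [Pi.sub_apply, Pi.smul_apply, listInsert_nil, listInsert_cons, contr_apply]
    rcases hφ.eq_one_or_nil_eq_zero with rfl | hφ₀
    · rcases hψ.eq_one_or_nil_eq_zero with rfl | hψ₀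
      · simp only [koszulSign_neg_one, hswap (φ []), one_smul, Units.neg_smul]
        abel
      · simp [hψ₀, hzero, hswap _ (0 : L)]
    · simp [hφ₀, hzero, hswap _ (0 : L)]
  | cons Z l ih =>
    have ihφ := ih (hφ.contr Z) hψ hf hs
    have ihψ := ih hφ (hψ.contr Z) hf hs
    have ihf := ih hφ hψ (hf.contr Z) (hs.contr Z)
    simp only [Pi.sub_apply, Pi.smul_apply] at ihφ ihψ ihf
    simp only [Pi.sub_apply, Pi.smul_apply, listInsert_cons, contr_listInsert, map_sub,
      listInsert_sub_left _ _ _ hf]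
    linear_combination (norm := skip) ihφ - ε • ihψ + (ε * δ) • ihf
    obtain rfl | rfl := Int.units_eq_one_or ε <;> obtain rfl | rfl := Int.units_eq_one_or δ <;>
      simp only [koszulSign_neg_one, koszulSign_one_left, koszulSign_one_right, one_smul,
        Units.neg_smul, neg_neg, mul_one, mul_neg_one, listInsert_neg_left _ _ hf, map_neg,
        Pi.neg_apply] <;>
      abel

end Insertion

section CovariantDerivative

variable {L N : Type*} [AddCommGroup L] [AddCommGroup N] (cA : L →+ L →+ L) (cE : L →+ N →+ N)

/-- The function `l ↦ ∇_{φ l} Z` obtained from `φ` and the connection `cA`. -/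
def covAlong (Z : L) : (List L → L) →+ List L → L := (cA.flip Z).compLeft _

/-- The values of the operator `listNabla` on a given list. -/
def listNablaAt : List L → ℤˣ → (List L → L) → (List L → N) →+ N
  | [], _, φ => (cE (φ [])).comp (Pi.evalAddMonoidHom _ [])
  | Z :: l, ε, φ => listNablaAt l (-ε) (contr Z φ) + ε • (listNablaAt l ε φ).comp (contr Z)
      - ε • listInsertAt l ε (covAlong cA Z φ)

/-- The operator `∇_φ` on functions on lists, for `φ` of sign `ε` and the connections `cA`
and `cE`. -/
def listNabla (ε : ℤˣ) (φ : List L → L) : (List L → N) →+ List L → N :=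
  AddMonoidHom.pi fun l => listNablaAt cA cE l ε φ

theorem covAlong_apply (Z : L) (φ : List L → L) (l : List L) :
    covAlong cA Z φ l = cA (φ l) Z := rfl

theorem contr_covAlong (Z Y : L) (φ : List L → L) :
    contr Y (covAlong cA Z φ) = covAlong cA Z (contr Y φ) := rfl

theorem HasSign.covAlong {ε : ℤˣ} {φ : List L → L} (hφ : HasSign ε φ) (Z : L) :
    HasSign ε (covAlong cA Z φ) := fun l hl => by
  rw [covAlong_apply, hφ l hl, map_zero, AddMonoidHom.zero_apply]

theorem covAlong_listInsert (Z : L) (ε : ℤˣ) (φ ψ : List L → L) :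
    covAlong cA Z (listInsert ε φ ψ) = listInsert ε φ (covAlong cA Z ψ) := by
  funext l
  induction l generalizing ε φ ψ with
  | nil => rfl
  | cons Y l ih =>
    have ihφ := ih (-ε) (contr Y φ) ψ
    have ihψ := ih ε φ (contr Y ψ)
    simp only [covAlong_apply] at ihφ ihψ
    simp only [covAlong_apply, listInsert_cons, map_sub, contr_covAlong, ← ihφ, ← ihψ,
      AddMonoidHom.sub_apply]
    obtain rfl | rfl := Int.units_eq_one_or ε <;> simp

theorem listNabla_nil (ε : ℤˣ) (φ : List L → L) (f : List L → N) :
    listNabla cA cE ε φ f [] = cE (φ []) (f []) := rfl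

theorem contr_listNabla (ε : ℤˣ) (φ : List L → L) (f : List L → N) (Z : L) :
    contr Z (listNabla cA cE ε φ f) = listNabla cA cE (-ε) (contr Z φ) f
      + ε • listNabla cA cE ε φ (contr Z f) - ε • listInsert ε (covAlong cA Z φ) f := rfl

theorem listNabla_cons (ε : ℤˣ) (φ : List L → L) (f : List L → N) (Z : L) (l : List L) :
    listNabla cA cE ε φ f (Z :: l) = listNabla cA cE (-ε) (contr Z φ) f l
      + ε • listNabla cA cE ε φ (contr Z f) l - ε • listInsert ε (covAlong cA Z φ) f l := rfl

theorem listNabla_add_left (ε : ℤˣ) (φ ψ : List L → L) {f : List L → N} (hf : IsMultiadditive f) :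
    listNabla cA cE ε (φ + ψ) f = listNabla cA cE ε φ f + listNabla cA cE ε ψ f := by
  funext l
  induction l generalizing ε φ ψ f with
  | nil => simp only [listNabla_nil, Pi.add_apply, map_add, AddMonoidHom.add_apply]
  | cons Z l ih =>
    simp only [Pi.add_apply, listNabla_cons, map_add, ih _ _ _ hf, ih _ _ _ (hf.contr Z),
      listInsert_add_left _ _ _ hf, smul_add]
    abel

theorem listNabla_sub_left (ε : ℤˣ) (φ ψ : List L → L) {f : List L → N} (hf : IsMultiadditive f) :
    listNabla cA cE ε (φ - ψ) f = listNabla cA cE ε φ f - listNabla cA cE ε ψ f :=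
  map_sub (AddMonoidHom.mk' (fun φ => listNabla cA cE ε φ f)
    fun φ ψ => listNabla_add_left cA cE ε φ ψ hf) φ ψ

theorem listNabla_neg_left (ε : ℤˣ) (φ : List L → L) {f : List L → N} (hf : IsMultiadditive f) :
    listNabla cA cE ε (-φ) f = -listNabla cA cE ε φ f :=
  map_neg (AddMonoidHom.mk' (fun φ => listNabla cA cE ε φ f)
    fun φ ψ => listNabla_add_left cA cE ε φ ψ hf) φ

theorem listNabla_listInsert {ε δ : ℤˣ} {φ ψ : List L → L} (hφ : HasSign ε φ)
    (hψ : HasSign δ ψ) {f : List L → N} (hf : IsMultiadditive f) (hs : IsSkew f) :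
    listNabla cA cE ε φ (listInsert δ ψ f)
        - koszulSign ε (-δ) • listInsert δ ψ (listNabla cA cE ε φ f)
      = listInsert (ε * δ) (listNabla cA cA ε φ ψ) f
        - koszulSign ε (-δ) • listNabla cA cE (-(ε * δ)) (listInsert δ ψ φ) f := by
  funext l
  induction l generalizing ε δ φ ψ f with
  | nil =>
    simp only [Pi.sub_apply, Pi.smul_apply, listInsert_nil, listNabla_nil, listNabla_cons,
      contr_apply, covAlong_apply]
    rcases hφ.eq_one_or_nil_eq_zero with rfl | hφ₀
    · simp only [koszulSign_one_left, one_smul]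
      abel
    · simp [hφ₀, hf.zero_cons]
  | cons Z l ih =>
    have ihφ := ih (hφ.contr Z) hψ hf hs
    have ihψ := ih hφ (hψ.contr Z) hf hs
    have ihf := ih hφ hψ (hf.contr Z) (hs.contr Z)
    have hInsert := congrFun (listInsert_listInsert (hφ.covAlong cA Z) hψ hf hs) l
    simp only [Pi.sub_apply, Pi.smul_apply] at ihφ ihψ ihf hInsert
    simp only [Pi.sub_apply, Pi.add_apply, Pi.smul_apply, listInsert_cons, listNabla_cons,
      contr_listInsert, contr_listNabla, covAlong_listInsert, map_sub, map_add,
      listInsert_sub_left _ _ _ hf, listInsert_add_left _ _ _ hf, listNabla_sub_left _ _ _ _ _ hf]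
    linear_combination (norm := skip) ihφ + ε • ihψ - (ε * δ) • ihf - ε • hInsert
    obtain rfl | rfl := Int.units_eq_one_or ε <;> obtain rfl | rfl := Int.units_eq_one_or δ <;>
      simp only [koszulSign_neg_one, koszulSign_one_left, koszulSign_one_right, one_smul,
        Units.neg_smul, neg_neg, mul_one, mul_neg_one, listInsert_neg_left _ _ hf,
        listNabla_neg_left _ _ _ _ hf, map_neg, Pi.neg_apply] <;>
      abel

end CovariantDerivative

section Curvature

variable {L N : Type*} [AddCommGroup L] [AddCommGroup N] (cA : L →+ L →+ L) (cE : L →+ N →+ N)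

/-- The curvature of the torsion-free connection `cA`, with `[x, y] = ∇_x y - ∇_y x`. -/
def torsionFreeCurvature (x y z : L) : L :=
  cA x (cA y z) - cA y (cA x z) - cA (cA x y - cA y x) z

/-- The skew product of `φ`, of sign `ε`, with `ψ` along the pairing `B`. -/
def listCup (B : L → L → N) : ℤˣ → (List L → L) → (List L → L) → List L → N
  | _, φ, ψ, [] => B (φ []) (ψ [])
  | ε, φ, ψ, Z :: l => listCup B (-ε) (contr Z φ) ψ l + ε • listCup B ε φ (contr Z ψ) l

theorem listCup_nil (B : L → L → N) (ε : ℤˣ) (φ ψ : List L → L) :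
    listCup B ε φ ψ [] = B (φ []) (ψ []) := rfl

theorem listCup_cons (B : L → L → N) (ε : ℤˣ) (φ ψ : List L → L) (Z : L) (l : List L) :
    listCup B ε φ ψ (Z :: l)
      = listCup B (-ε) (contr Z φ) ψ l + ε • listCup B ε φ (contr Z ψ) l := rfl

/-- The form `R(φ, ψ)` as a function on lists, for `φ` and `ψ` of signs `ε` and `δ`. -/
def listCurv (R : L → L → L → N) : ℤˣ → ℤˣ → (List L → L) → (List L → L) → List L → N
  | _, _, _, _, [] => 0
  | ε, δ, φ, ψ, Z :: l => listCurv R (-ε) δ (contr Z φ) ψ l + ε • listCurv R ε (-δ) φ (contr Z ψ) l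
      + (ε * δ) • listCup (fun x y => R x y Z) ε φ ψ l

theorem contr_listCurv (R : L → L → L → N) (ε δ : ℤˣ) (φ ψ : List L → L) (Z : L) :
    contr Z (listCurv R ε δ φ ψ)
      = listCurv R (-ε) δ (contr Z φ) ψ + ε • listCurv R ε (-δ) φ (contr Z ψ)
        + (ε * δ) • listCup (fun x y => R x y Z) ε φ ψ := rfl

theorem listNabla_covAlong {ε δ : ℤˣ} {φ ψ : List L → L} (hφ : HasSign ε φ) (hψ : HasSign δ ψ)
    (Z : L) :
    listNabla cA cA ε φ (covAlong cA Z ψ) - covAlong cA Z (listNabla cA cA ε φ ψ)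
        - koszulSign ε δ • (listNabla cA cA δ ψ (covAlong cA Z φ)
          - covAlong cA Z (listNabla cA cA δ ψ φ))
      = listCup (fun x y => torsionFreeCurvature cA x y Z) ε φ ψ := by
  funext l
  induction l generalizing ε δ φ ψ with
  | nil =>
    simp only [Pi.sub_apply, Pi.smul_apply, listNabla_nil, covAlong_apply, listCup_nil,
      torsionFreeCurvature]
    rcases hφ.eq_one_or_nil_eq_zero with rfl | hφ₀
    · simp only [koszulSign_one_left, one_smul, map_sub, AddMonoidHom.sub_apply]
      abel
    · simp [hφ₀]
  | cons Y l ih =>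
    have ihφ := ih (hφ.contr Y) hψ
    have ihψ := ih hφ (hψ.contr Y)
    simp only [Pi.sub_apply, Pi.smul_apply, covAlong_apply] at ihφ ihψ
    simp only [Pi.sub_apply, Pi.smul_apply, listCup_cons, listNabla_cons, covAlong_apply,
      contr_covAlong, map_add, map_sub, AddMonoidHom.sub_apply, AddMonoidHom.add_apply]
    linear_combination (norm := skip) ihφ + ε • ihψ
    obtain rfl | rfl := Int.units_eq_one_or ε <;> obtain rfl | rfl := Int.units_eq_one_or δ <;>
      simp only [koszulSign_neg_one, koszulSign_one_left, koszulSign_one_right, one_smul,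
        Units.neg_smul, neg_neg, map_neg, AddMonoidHom.neg_apply, ← covAlong_listInsert,
        covAlong_apply] <;>
      abel

theorem listNabla_listNabla
    (hflat : ∀ x y n, cE x (cE y n) - cE y (cE x n) - cE (cA x y - cA y x) n = 0)
    {ε δ : ℤˣ} {φ ψ : List L → L} (hφ : HasSign ε φ) (hψ : HasSign δ ψ) {f : List L → N}
    (hf : IsMultiadditive f) (hs : IsSkew f) :
    listNabla cA cE ε φ (listNabla cA cE δ ψ f)
        - koszulSign ε δ • listNabla cA cE δ ψ (listNabla cA cE ε φ f)
      = listNabla cA cE (ε * δ) (listNabla cA cA ε φ ψ) f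
        - koszulSign ε δ • listNabla cA cE (ε * δ) (listNabla cA cA δ ψ φ) f
        - listInsert (-(ε * δ)) (listCurv (torsionFreeCurvature cA) ε δ φ ψ) f := by
  funext l
  induction l generalizing ε δ φ ψ f with
  | nil =>
    simp only [Pi.sub_apply, Pi.smul_apply, listInsert_nil, listNabla_nil, listCurv, hf.zero_cons]
    rcases hφ.eq_one_or_nil_eq_zero with rfl | hφ₀
    · have h := hflat (φ []) (ψ []) (f [])
      simp only [map_sub, AddMonoidHom.sub_apply] at h
      rw [koszulSign_one_left, one_smul, one_smul]
      linear_combination (norm := abel) h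
    · simp [hφ₀]
  | cons Z l ih =>
    have ihφ := ih (hφ.contr Z) hψ hf hs
    have ihψ := ih hφ (hψ.contr Z) hf hs
    have ihf := ih hφ hψ (hf.contr Z) (hs.contr Z)
    have hφψ := congrFun (listNabla_listInsert cA cE hφ (hψ.covAlong cA Z) hf hs) l
    have hψφ := congrFun (listNabla_listInsert cA cE hψ (hφ.covAlong cA Z) hf hs) l
    have hcurv := congrFun (congrArg (fun g => listInsert (ε * δ) g f)
      (listNabla_covAlong cA hφ hψ Z)) l
    simp only [Pi.sub_apply, Pi.smul_apply, listInsert_sub_left _ _ _ hf]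
      at ihφ ihψ ihf hφψ hψφ hcurv
    simp only [Pi.sub_apply, Pi.smul_apply, Pi.add_apply, listInsert_cons, contr_listNabla,
      listNabla_cons, contr_listCurv, map_sub, map_add, listInsert_add_left _ _ _ hf,
      listNabla_sub_left _ _ _ _ _ hf, listNabla_add_left _ _ _ _ _ hf]
    linear_combination (norm := skip) ihφ + ε • ihψ + (ε * δ) • ihf - (ε * δ) • hφψ
      + (koszulSign ε δ * ε * δ) • hψφ - (ε * δ) • hcurv
    obtain rfl | rfl := Int.units_eq_one_or ε <;> obtain rfl | rfl := Int.units_eq_one_or δ <;>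
      simp only [koszulSign_neg_one, koszulSign_one_left, koszulSign_one_right, one_smul,
        Units.neg_smul, neg_neg, mul_one, mul_neg_one, listInsert_neg_left _ _ hf,
        listInsert_sub_left _ _ _ hf, listNabla_neg_left _ _ _ _ hf, map_neg, Pi.neg_apply,
        Pi.sub_apply] <;>
      abel

end Curvature

section ExteriorDerivative

variable {L N : Type*} [AddCommGroup L] [AddCommGroup N] (cA : L →+ L →+ L) (cE : L →+ N →+ N)
  (br : L → L → L)

/-- The values of the operator `listLie` on a given list. -/
def listLieAt (Z : L) : List L → (List L → N) →+ N
  | [] => (cE Z).comp (Pi.evalAddMonoidHom _ [])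
  | Y :: l => (listLieAt Z l).comp (contr Y) - Pi.evalAddMonoidHom _ (br Z Y :: l)

/-- The Lie derivative along `Z` on functions on lists, for the bracket `br` and the
connection `cE`. -/
def listLie (Z : L) : (List L → N) →+ List L → N := AddMonoidHom.pi (listLieAt cE br Z)

/-- The values of the operator `listDeriv` on a given list. -/
def listDerivAt : List L → (List L → N) →+ N
  | [] => 0
  | Z :: l => listLieAt cE br Z l - (listDerivAt l).comp (contr Z)

/-- The exterior derivative on functions on lists, for the bracket `br` and the connection `cE`.
Its recursion is Cartan's formula `i_Z d = L_Z - d i_Z`. -/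
def listDeriv : (List L → N) →+ List L → N := AddMonoidHom.pi (listDerivAt cE br)

theorem listLie_nil (Z : L) (f : List L → N) : listLie cE br Z f [] = cE Z (f []) := rfl

theorem contr_listLie (Z : L) (f : List L → N) (Y : L) :
    contr Y (listLie cE br Z f) = listLie cE br Z (contr Y f) - contr (br Z Y) f := rfl

theorem listLie_cons (Z : L) (f : List L → N) (Y : L) (l : List L) :
    listLie cE br Z f (Y :: l) = listLie cE br Z (contr Y f) l - f (br Z Y :: l) := rfl

theorem listDeriv_nil (f : List L → N) : listDeriv cE br f [] = 0 := rfl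

theorem contr_listDeriv (f : List L → N) (Z : L) :
    contr Z (listDeriv cE br f) = listLie cE br Z f - listDeriv cE br (contr Z f) := rfl

theorem listDeriv_cons (f : List L → N) (Z : L) (l : List L) :
    listDeriv cE br f (Z :: l) = listLie cE br Z f l - listDeriv cE br (contr Z f) l := rfl

variable {br}

theorem listLie_listInsert (hbr : ∀ x y, br x y = cA x y - cA y x) (Z : L) (ε : ℤˣ)
    (φ : List L → L) {f : List L → N} (hf : IsMultiadditive f) :
    listLie cE br Z (listInsert ε φ f) - listInsert ε φ (listLie cE br Z f)
      = listInsert ε (listLie cA br Z φ) f - listInsert ε (covAlong cA Z φ) f := by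
  funext l
  induction l generalizing ε φ f with
  | nil =>
    simp only [Pi.sub_apply, listLie_nil, listInsert_nil, listLie_cons, contr_apply,
      covAlong_apply, hbr, hf.sub_cons]
    abel
  | cons Y l ih =>
    have ihφ := ih (-ε) (contr Y φ) hf
    have ihf := ih ε φ (hf.contr Y)
    simp only [Pi.sub_apply] at ihφ ihf
    simp only [Pi.sub_apply, listLie_cons, listInsert_cons, contr_listInsert, contr_listLie,
      contr_covAlong, map_sub, listInsert_sub_left _ _ _ hf]
    linear_combination (norm := skip) ihφ - ε • ihf
    obtain rfl | rfl := Int.units_eq_one_or ε <;>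
      simp only [one_smul, Units.neg_smul, map_neg, Pi.neg_apply] <;>
      abel

theorem listNabla_eq (hbr : ∀ x y, br x y = cA x y - cA y x) (ε : ℤˣ) (φ : List L → L)
    {f : List L → N} (hf : IsMultiadditive f) :
    listNabla cA cE ε φ f = listInsert ε φ (listDeriv cE br f)
      + ε • listDeriv cE br (listInsert ε φ f) - ε • listInsert (-ε) (listDeriv cA br φ) f := by
  funext l
  induction l generalizing ε φ f with
  | nil =>
    simp only [Pi.sub_apply, Pi.add_apply, Pi.smul_apply, listNabla_nil, listInsert_nil,
      listDeriv_cons, listDeriv_nil, listLie_nil, hf.zero_cons, smul_zero, sub_zero, add_zero]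
  | cons Z l ih =>
    have ihφ := ih (-ε) (contr Z φ) hf
    have ihf := ih ε φ (hf.contr Z)
    have hLie := congrFun (listLie_listInsert cA cE hbr Z ε φ hf) l
    simp only [Pi.sub_apply, Pi.add_apply, Pi.smul_apply] at ihφ ihf hLie
    simp only [Pi.sub_apply, Pi.add_apply, Pi.smul_apply, listNabla_cons, listInsert_cons,
      listDeriv_cons, contr_listInsert, contr_listDeriv, map_sub, listInsert_sub_left _ _ _ hf]
    linear_combination (norm := skip) ihφ + ε • ihf - ε • hLie
    obtain rfl | rfl := Int.units_eq_one_or ε <;>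
      simp only [one_smul, Units.neg_smul, neg_neg, map_neg, Pi.neg_apply] <;>
      abel

end ExteriorDerivative

section ShuffleRecursion

/-- The permutation of `Fin (n + 1)` which sends `p` to `0` and is `τ` on the other entries. -/
def consPerm {n : ℕ} (p : Fin (n + 1)) (τ : Equiv.Perm (Fin n)) : Equiv.Perm (Fin (n + 1)) :=
  Equiv.Perm.decomposeFin.symm (0, τ) * p.cycleRange

theorem consPerm_self {n : ℕ} (p : Fin (n + 1)) (τ : Equiv.Perm (Fin n)) :
    consPerm p τ p = 0 := by
  rw [consPerm, Equiv.Perm.mul_apply, Fin.cycleRange_self,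
    Equiv.Perm.decomposeFin_symm_apply_zero]

theorem consPerm_succAbove {n : ℕ} (p : Fin (n + 1)) (τ : Equiv.Perm (Fin n)) (j : Fin n) :
    consPerm p τ (p.succAbove j) = (τ j).succ := by
  rw [consPerm, Equiv.Perm.mul_apply, Fin.cycleRange_succAbove,
    Equiv.Perm.decomposeFin_symm_apply_succ, Equiv.swap_self, Equiv.refl_apply]

theorem sign_consPerm {n : ℕ} (p : Fin (n + 1)) (τ : Equiv.Perm (Fin n)) :
    Equiv.Perm.sign (consPerm p τ) = (-1) ^ (p : ℕ) * Equiv.Perm.sign τ := by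
  rw [consPerm, Equiv.Perm.sign_mul, Equiv.Perm.decomposeFin.symm_sign, Fin.sign_cycleRange,
    if_pos rfl, one_mul, mul_comm]

theorem consPerm_bijective (n : ℕ) :
    Function.Bijective fun x : Fin (n + 1) × Equiv.Perm (Fin n) => consPerm x.1 x.2 := by
  rw [Fintype.bijective_iff_injective_and_card]
  refine ⟨?_, ?_⟩
  · rintro ⟨p, τ⟩ ⟨p', τ'⟩ (h : consPerm p τ = consPerm p' τ')
    obtain rfl : p = p' := by
      rw [← (consPerm p τ).apply_eq_iff_eq, consPerm_self, h, consPerm_self]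
    refine congrArg _ (Equiv.ext fun j => Fin.succ_injective _ ?_)
    rw [← consPerm_succAbove p, h, consPerm_succAbove]
  · rw [Fintype.card_prod, Fintype.card_perm, Fintype.card_perm, Fintype.card_fin,
      Fintype.card_fin, Nat.factorial_succ]

theorem sum_perm_succ {N : Type*} [AddCommMonoid N] {n : ℕ} (F : Equiv.Perm (Fin (n + 1)) → N) :
    ∑ σ, F σ = ∑ p, ∑ τ, F (consPerm p τ) := by
  rw [← Fintype.sum_prod_type', ← (consPerm_bijective n).sum_comp]

theorem forall_consPerm_lt_iff {n : ℕ} (S : Fin (n + 1) → Fin (n + 1) → Prop) (p : Fin (n + 1))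
    (τ : Equiv.Perm (Fin n)) :
    (∀ i j, i < j → S i j → consPerm p τ i < consPerm p τ j) ↔
      (∀ i < p, ¬ S i p) ∧ ∀ i j, i < j → S (p.succAbove i) (p.succAbove j) → τ i < τ j := by
  refine ⟨fun h => ⟨fun i hi hs => ?_, fun i j hij hs => ?_⟩, fun ⟨h₁, h₂⟩ i j hij hs => ?_⟩
  · simpa [consPerm_self] using h i p hi hs
  · simpa [consPerm_succAbove] using h _ _ (Fin.succAbove_lt_succAbove_iff.mpr hij) hs
  · rcases Fin.eq_self_or_eq_succAbove p j with rfl | ⟨j, rfl⟩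
    · exact absurd hs (h₁ i hij)
    · rcases Fin.eq_self_or_eq_succAbove p i with rfl | ⟨i, rfl⟩
      · simp [consPerm_self, consPerm_succAbove]
      · simpa [consPerm_succAbove] using h₂ i j (Fin.succAbove_lt_succAbove_iff.mp hij) hs

theorem ofFn_comp_consPerm {L : Type*} {n : ℕ} (Z : L) (v : Fin n → L) (p : Fin (n + 1))
    (τ : Equiv.Perm (Fin n)) :
    List.ofFn ((Fin.cons Z v : Fin (n + 1) → L) ∘ consPerm p τ)
      = (List.ofFn (v ∘ τ)).insertIdx p Z := by
  refine List.ext_getElem (by grind) fun i h₁ h₂ => ?_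
  rw [List.getElem_ofFn, Function.comp_apply]
  rcases Fin.eq_self_or_eq_succAbove p ⟨i, by simpa using h₁⟩ with h | ⟨j, h⟩
  · rw [h, consPerm_self, Fin.cons_zero]
    grind
  · rw [h, consPerm_succAbove, Fin.cons_succ]
    have hi : i = if (j : ℕ) < p then (j : ℕ) else j + 1 := by
      have := congrArg Fin.val h
      grind [Fin.succAbove]
    subst hi
    grind

theorem mem_shuffles₃_consPerm {k l n : ℕ} (p : Fin (n + 1)) (τ : Equiv.Perm (Fin n)) :
    consPerm p τ ∈ shuffles₃ k l (n + 1) ↔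
      ((p : ℕ) = 0 ∧ 0 < k ∧ τ ∈ shuffles₃ (k - 1) l n) ∨
      ((p : ℕ) = k ∧ 0 < l ∧ τ ∈ shuffles₃ k (l - 1) n) ∨
      ((p : ℕ) = k + l ∧ τ ∈ shuffles₃ k l n) := by
  have hfirst : (∀ i : Fin (n + 1), i < p → ¬ ((p : ℕ) < k ∨
      (k ≤ (i : ℕ) ∧ (p : ℕ) < k + l) ∨ k + l ≤ (i : ℕ))) ↔
      ((p : ℕ) = 0 ∧ 0 < k) ∨ ((p : ℕ) = k ∧ 0 < l) ∨ (p : ℕ) = k + l := by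
    refine ⟨fun h => ?_, fun h i hi => by omega⟩
    rcases Nat.eq_zero_or_pos p with h₀ | h₀
    · omega
    · have h₁ := h ⟨0, by omega⟩ h₀
      have h₂ := h ⟨p - 1, by omega⟩ (by rw [Fin.lt_def]; exact Nat.sub_lt h₀ one_pos)
      simp only at h₁ h₂
      omega
  simp only [shuffles₃, Finset.mem_filter, Finset.mem_univ, true_and]
  rw [forall_consPerm_lt_iff (fun i j : Fin (n + 1) => (j : ℕ) < k ∨
    (k ≤ (i : ℕ) ∧ (j : ℕ) < k + l) ∨ k + l ≤ (i : ℕ)), hfirst, or_and_right, or_and_right,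
    and_assoc, and_assoc]
  refine or_congr ?_ (or_congr ?_ ?_) <;>
    simp only [and_congr_right_iff] <;> intros <;>
    refine forall_congr' fun i => forall_congr' fun j => forall_congr' fun hij =>
      imp_congr_left ?_ <;>
    grind [Fin.succAbove]

theorem sum_ite_or_or {ι N : Type*} [Fintype ι] [DecidableEq ι] [AddCommMonoid N] {A B C : Prop}
    [Decidable A] [Decidable B] [Decidable C] (hAB : A → ¬B) (hAC : A → ¬C) (hBC : B → ¬C)
    (s t u : Finset ι) (F : ι → N) :
    ∑ i, (if A ∧ i ∈ s ∨ B ∧ i ∈ t ∨ C ∧ i ∈ u then F i else 0)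
      = (if A then ∑ i ∈ s, F i else 0) + (if B then ∑ i ∈ t, F i else 0)
        + (if C then ∑ i ∈ u, F i else 0) := by
  by_cases hA : A <;> by_cases hB : B <;> by_cases hC : C <;> simp_all

theorem sum_shuffles₃_succ {N : Type*} [AddCommMonoid N] {k l n : ℕ} (h : k + l ≤ n + 1)
    (F : Equiv.Perm (Fin (n + 1)) → N) :
    ∑ σ ∈ shuffles₃ k l (n + 1), F σ =
      (if 0 < k then ∑ τ ∈ shuffles₃ (k - 1) l n, F (consPerm 0 τ) else 0) +
      (if 0 < l then ∑ τ ∈ shuffles₃ k (l - 1) n, F (consPerm (Fin.ofNat (n + 1) k) τ) else 0) +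
      (if k + l ≤ n then ∑ τ ∈ shuffles₃ k l n, F (consPerm (Fin.ofNat (n + 1) (k + l)) τ)
        else 0) := by
  have hp : ∀ p : Fin (n + 1), ∑ τ, (if consPerm p τ ∈ shuffles₃ k l (n + 1) then
      F (consPerm p τ) else 0) =
      (if p = 0 then
        if 0 < k then ∑ τ ∈ shuffles₃ (k - 1) l n, F (consPerm p τ) else 0 else 0) +
      (if p = Fin.ofNat (n + 1) k then
        if 0 < l then ∑ τ ∈ shuffles₃ k (l - 1) n, F (consPerm p τ) else 0 else 0) +
      (if p = Fin.ofNat (n + 1) (k + l) then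
        if k + l ≤ n then ∑ τ ∈ shuffles₃ k l n, F (consPerm p τ) else 0 else 0) := by
    intro p
    have := p.2
    have h₁ : (p = 0 ∧ 0 < k) ↔ ((p : ℕ) = 0 ∧ 0 < k) := by
      rw [Fin.ext_iff, Fin.val_zero]
    have h₂ : (p = Fin.ofNat (n + 1) k ∧ 0 < l) ↔ ((p : ℕ) = k ∧ 0 < l) := by
      refine and_congr_left fun hl => ?_
      rw [Fin.ext_iff, Fin.val_ofNat, Nat.mod_eq_of_lt (by omega)]
    have h₃ : (p = Fin.ofNat (n + 1) (k + l) ∧ k + l ≤ n) ↔ (p : ℕ) = k + l := by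
      rw [Fin.ext_iff, Fin.val_ofNat]
      refine ⟨fun ⟨h, hl⟩ => by rwa [Nat.mod_eq_of_lt (by omega)] at h, fun h => ?_⟩
      rw [Nat.mod_eq_of_lt (by omega)]
      omega
    simp only [mem_shuffles₃_consPerm, ← ite_and, h₁, h₂, h₃, ← and_assoc]
    exact sum_ite_or_or (by omega) (by omega) (by omega) _ _ _ _
  rw [← Fintype.sum_ite_mem, sum_perm_succ, Finset.sum_congr rfl fun p _ => hp p]
  simp only [Finset.sum_add_distrib, Finset.sum_ite_eq', Finset.mem_univ, if_true]

end ShuffleRecursion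

section Blocks

variable {L N : Type*}

theorem drop_insertIdx {w : List L} {k p : ℕ} (hk : k ≤ p) (hp : p ≤ w.length) (Z : L) :
    (w.insertIdx p Z).drop k = (w.drop k).insertIdx (p - k) Z := by
  refine List.ext_getElem (by grind) fun i h₁ h₂ => ?_
  grind

/-- The value of `H` on the blocks formed by the first `k`, the next `l` and the remaining entries
of a list. -/
def onBlocks (k l : ℕ) (H : List L → List L → List L → N) (w : List L) : N :=
  H (w.take k) ((w.drop k).take l) ((w.drop k).drop l)

theorem onBlocks_insertIdx_zero (k l : ℕ) (H : List L → List L → List L → N) (Z : L)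
    (w : List L) :
    onBlocks (k + 1) l H (w.insertIdx 0 Z) = onBlocks k l (fun a b c => H (Z :: a) b c) w := rfl

theorem onBlocks_insertIdx_left {k l : ℕ} (H : List L → List L → List L → N) (Z : L)
    {w : List L} (h : k ≤ w.length) :
    onBlocks k (l + 1) H (w.insertIdx k Z) = onBlocks k l (fun a b c => H a (Z :: b) c) w := by
  simp only [onBlocks, List.take_insertIdx_eq_take_of_le _ _ _ _ le_rfl, drop_insertIdx le_rfl h,
    Nat.sub_self, List.insertIdx_zero, List.take_succ_cons, List.drop_succ_cons]

theorem onBlocks_insertIdx_right {k l : ℕ} (H : List L → List L → List L → N) (Z : L)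
    {w : List L} (h : k + l ≤ w.length) :
    onBlocks k l H (w.insertIdx (k + l) Z) = onBlocks k l (fun a b c => H a b (Z :: c)) w := by
  have h' : l ≤ (w.drop k).length := by rw [List.length_drop]; omega
  simp only [onBlocks, List.take_insertIdx_eq_take_of_le _ _ _ _ (Nat.le_add_right k l),
    drop_insertIdx (Nat.le_add_right k l) h, Nat.add_sub_cancel_left,
    List.take_insertIdx_eq_take_of_le _ _ _ _ le_rfl, drop_insertIdx le_rfl h', Nat.sub_self,
    List.insertIdx_zero]

variable [AddCommGroup N] {n : ℕ}

theorem sign_smul_onBlocks_consPerm_zero (k l : ℕ) (H : List L → List L → List L → N) (Z : L)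
    (v : Fin n → L) (τ : Equiv.Perm (Fin n)) :
    Equiv.Perm.sign (consPerm 0 τ) •
        onBlocks (k + 1) l H (List.ofFn ((Fin.cons Z v : Fin (n + 1) → L) ∘ consPerm 0 τ))
      = Equiv.Perm.sign τ • onBlocks k l (fun a b c => H (Z :: a) b c) (List.ofFn (v ∘ τ)) := by
  rw [sign_consPerm, ofFn_comp_consPerm, Fin.val_zero, pow_zero, one_mul,
    ← onBlocks_insertIdx_zero]

theorem sign_smul_onBlocks_consPerm_left {k : ℕ} {p : Fin (n + 1)} (hp : (p : ℕ) = k) (l : ℕ)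
    (H : List L → List L → List L → N) (Z : L) (v : Fin n → L) (τ : Equiv.Perm (Fin n)) :
    Equiv.Perm.sign (consPerm p τ) •
        onBlocks k (l + 1) H (List.ofFn ((Fin.cons Z v : Fin (n + 1) → L) ∘ consPerm p τ))
      = Equiv.Perm.sign τ • onBlocks k l
        (fun a b c => (-1 : ℤˣ) ^ a.length • H a (Z :: b) c) (List.ofFn (v ∘ τ)) := by
  rw [sign_consPerm, ofFn_comp_consPerm, hp, mul_comm, mul_smul,
    onBlocks_insertIdx_left _ _ (by rw [List.length_ofFn]; omega)]
  simp only [onBlocks, List.length_take, List.length_ofFn]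
  rw [min_eq_left (by omega)]

theorem sign_smul_onBlocks_consPerm_right {k l : ℕ} {p : Fin (n + 1)} (hp : (p : ℕ) = k + l)
    (H : List L → List L → List L → N) (Z : L) (v : Fin n → L) (τ : Equiv.Perm (Fin n)) :
    Equiv.Perm.sign (consPerm p τ) •
        onBlocks k l H (List.ofFn ((Fin.cons Z v : Fin (n + 1) → L) ∘ consPerm p τ))
      = Equiv.Perm.sign τ • onBlocks k l
        (fun a b c => (-1 : ℤˣ) ^ (a.length + b.length) • H a b (Z :: c))
        (List.ofFn (v ∘ τ)) := by
  rw [sign_consPerm, ofFn_comp_consPerm, hp, mul_comm, mul_smul,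
    onBlocks_insertIdx_right _ _ (by rw [List.length_ofFn]; omega)]
  simp only [onBlocks, List.length_take, List.length_ofFn, List.length_drop]
  rw [min_eq_left (by omega), min_eq_left (by omega)]

end Blocks

section Unshuffle

variable {L N : Type*} [AddCommGroup N]

/-- The signed sum of `H a b c` over all the ways to distribute the entries of a list into three
sublists `a`, `b` and `c`. The signs account for moving an entry past the sublists preceding its
own. -/
def unshuffle₃ : (List L → List L → List L → N) → List L → N
  | H, [] => H [] [] []
  | H, Z :: t => unshuffle₃ (fun a b c => H (Z :: a) b c) t
      + unshuffle₃ (fun a b c => (-1 : ℤˣ) ^ a.length • H a (Z :: b) c) t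
      + unshuffle₃ (fun a b c => (-1 : ℤˣ) ^ (a.length + b.length) • H a b (Z :: c)) t

theorem unshuffle₃_smul (u : ℤˣ) (H : List L → List L → List L → N) (t : List L) :
    unshuffle₃ (fun a b c => u • H a b c) t = u • unshuffle₃ H t := by
  induction t generalizing H with
  | nil => rfl
  | cons Z t ih => simp only [unshuffle₃, smul_comm _ u, ih, smul_add]

theorem unshuffle₃_eq_zero {H : List L → List L → List L → N} {t : List L}
    (h : ∀ a b c, a.length + b.length + c.length = t.length → H a b c = 0) :
    unshuffle₃ H t = 0 := by
  induction t generalizing H with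
  | nil => exact h [] [] [] rfl
  | cons Z t ih =>
    rw [unshuffle₃, ih, ih, ih, add_zero, add_zero] <;> intro a b c habc
    · rw [h, smul_zero]
      grind
    · rw [h, smul_zero]
      grind
    · exact h _ _ _ (by grind)

theorem sum_shuffles₃ {k l n : ℕ} (hn : k + l ≤ n) {H : List L → List L → List L → N}
    (hH : ∀ a b c, ¬(a.length = k ∧ b.length = l) → H a b c = 0) (v : Fin n → L) :
    ∑ σ ∈ shuffles₃ k l n, Equiv.Perm.sign σ • onBlocks k l H (List.ofFn (v ∘ σ))
      = unshuffle₃ H (List.ofFn v) := by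
  induction n generalizing k l H with
  | zero =>
    obtain ⟨rfl, rfl⟩ : k = 0 ∧ l = 0 := by omega
    simp [unshuffle₃, shuffles₃, onBlocks]
  | succ n ih =>
    obtain ⟨Z, v, rfl⟩ : ∃ Z w, v = Fin.cons Z w := ⟨_, _, (Fin.cons_self_tail v).symm⟩
    have hval : ∀ p ≤ n, (Fin.ofNat (n + 1) p : ℕ) = p := fun p hp =>
      Nat.mod_eq_of_lt (Nat.lt_succ_of_le hp)
    rw [sum_shuffles₃_succ hn, List.ofFn_cons, unshuffle₃]
    congr 2
    · split_ifs with hk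
      · obtain ⟨k, rfl⟩ := Nat.exists_eq_succ_of_ne_zero hk.ne'
        rw [← ih (k := k) (l := l) (by omega) fun a b c h => hH _ _ _ (by grind)]
        exact Finset.sum_congr rfl fun τ _ => sign_smul_onBlocks_consPerm_zero k l H Z v τ
      · exact (unshuffle₃_eq_zero fun a b c _ => hH _ _ _ (by grind)).symm
    · split_ifs with hl
      · obtain ⟨l, rfl⟩ := Nat.exists_eq_succ_of_ne_zero hl.ne'
        rw [← ih (k := k) (l := l) (by omega) fun a b c h => by rw [hH, smul_zero]; grind]
        exact Finset.sum_congr rfl fun τ _ =>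
          sign_smul_onBlocks_consPerm_left (hval _ (by omega)) l H Z v τ
      · exact (unshuffle₃_eq_zero fun a b c _ => by rw [hH, smul_zero]; grind).symm
    · split_ifs with hkl
      · rw [← ih (k := k) (l := l) (by omega) fun a b c h => by rw [hH _ _ _ h, smul_zero]]
        exact Finset.sum_congr rfl fun τ _ =>
          sign_smul_onBlocks_consPerm_right (hval _ hkl) H Z v τ
      · refine (unshuffle₃_eq_zero fun a b c habc => ?_).symm
        rw [List.length_ofFn] at habc
        rw [hH _ _ _ (by grind), smul_zero]

end Unshuffle


section Unshuffle₂

variable {L N : Type*} [AddCommGroup N]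

/-- The signed sum of `K a b` over all the ways to distribute the entries of a list into two
sublists `a` and `b`. -/
def unshuffle₂ : (List L → List L → N) → List L → N
  | K, [] => K [] []
  | K, Z :: t => unshuffle₂ (fun a b => K (Z :: a) b) t
      + unshuffle₂ (fun a b => (-1 : ℤˣ) ^ a.length • K a (Z :: b)) t

theorem unshuffle₂_smul (u : ℤˣ) (K : List L → List L → N) (t : List L) :
    unshuffle₂ (fun a b => u • K a b) t = u • unshuffle₂ K t := by
  induction t generalizing K with
  | nil => rfl
  | cons Z t ih => simp only [unshuffle₂, smul_comm _ u, ih, smul_add]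

theorem unshuffle₃_nil_left (K : List L → List L → N) (t : List L) :
    unshuffle₃ (fun a b c => if a = [] then K b c else 0) t = unshuffle₂ K t := by
  induction t generalizing K with
  | nil => rfl
  | cons Z t ih =>
    rw [unshuffle₃, unshuffle₂, ← ih, ← ih, unshuffle₃_eq_zero fun a b c _ => if_neg (by simp),
      zero_add]
    congr 2 <;> funext a b c <;> by_cases ha : a = [] <;> simp [ha]

theorem unshuffle₃_nil_right (K : List L → List L → N) (t : List L) :
    unshuffle₃ (fun a b c => if c = [] then K a b else 0) t = unshuffle₂ K t := by
  induction t generalizing K with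
  | nil => rfl
  | cons Z t ih =>
    rw [unshuffle₃, unshuffle₂, ← ih, ← ih,
      add_eq_left.2 (unshuffle₃_eq_zero fun a b c _ => by simp)]
    congr 2
    funext a b c
    by_cases hc : c = [] <;> simp [hc]

theorem unshuffle₂_eq_zero {K : List L → List L → N} {t : List L}
    (h : ∀ a b, a.length + b.length = t.length → K a b = 0) : unshuffle₂ K t = 0 := by
  rw [← unshuffle₃_nil_left, unshuffle₃_eq_zero]
  intro a b c habc
  split_ifs with ha
  · exact h b c (by simpa [ha] using habc)
  · rfl

theorem unshuffle₂_nil_left (g : List L → N) (t : List L) :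
    unshuffle₂ (fun a b => if a = [] then g b else 0) t = g t := by
  induction t generalizing g with
  | nil => rfl
  | cons Z t ih =>
    have h : ∀ a b : List L, (-1 : ℤˣ) ^ a.length • (if a = [] then g (Z :: b) else 0)
        = if a = [] then g (Z :: b) else 0 := fun a b => by
      split_ifs with ha <;> simp [ha]
    simp only [unshuffle₂, h, ih]
    rw [unshuffle₂_eq_zero fun a b _ => if_neg (List.cons_ne_nil Z a), zero_add]

theorem unshuffle₂_neg (K : List L → List L → N) (t : List L) :
    unshuffle₂ (fun a b => -K a b) t = -unshuffle₂ K t := by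
  simpa only [Units.neg_smul, one_smul] using unshuffle₂_smul (-1) K t

end Unshuffle₂

section SmallLists

variable {L N : Type*} [AddCommGroup N]

/-- The function on lists which is `F x` on `[x]` and vanishes on the lists of length `≠ 1`. -/
def onSingleton : (L → N) →+ List L → N where
  toFun F
    | [x] => F x
    | _ => 0
  map_zero' := funext fun
    | [] | [_] | _ :: _ :: _ => rfl
  map_add' _ _ := funext fun
    | [_] => rfl
    | [] | _ :: _ :: _ => (add_zero 0).symm

/-- The function on lists which is `F x y` on `[x, y]` and vanishes on the lists of
length `≠ 2`. -/
def onPair (F : L → L → N) : List L → N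
  | [] => 0
  | x :: l => onSingleton (F x) l

theorem onSingleton_of_length_ne {F : L → N} {l : List L} (h : l.length ≠ 1) :
    onSingleton F l = 0 := by
  match l, h with
  | [], _ | _ :: _ :: _, _ => rfl

theorem onPair_of_length_ne {F : L → L → N} {l : List L} (h : l.length ≠ 2) :
    onPair F l = 0 := by
  match l, h with
  | [], _ => rfl
  | _ :: _, h => exact onSingleton_of_length_ne (by simpa using h)

theorem onSingleton_cons (F : L → N) (Z : L) (l : List L) :
    onSingleton F (Z :: l) = if l = [] then F Z else 0 := by
  cases l <;> rfl

theorem neg_one_pow_smul_onSingleton (F : L → N) (l : List L) :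
    (-1 : ℤˣ) ^ l.length • onSingleton F l = -onSingleton F l := by
  by_cases h : l.length = 1
  · rw [h, pow_one, Units.neg_smul, one_smul]
  · rw [onSingleton_of_length_ne h, smul_zero, neg_zero]

theorem neg_one_pow_smul_onPair (F : L → L → N) (l : List L) :
    (-1 : ℤˣ) ^ l.length • onPair F l = onPair F l := by
  by_cases h : l.length = 2
  · rw [h, neg_one_sq, one_smul]
  · rw [onPair_of_length_ne h, smul_zero]

theorem onPair_neg (F : L → L → N) (l : List L) :
    onPair (fun x y => -F x y) l = -onPair F l := by
  cases l with
  | nil => exact neg_zero.symm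
  | cons x l => exact congrFun (map_neg onSingleton (F x)) l

theorem onPair_cons (F : L → L → N) (Z : L) (l : List L) :
    onPair F (Z :: l) = onSingleton (F Z) l := rfl

theorem unshuffle₂_onSingleton_cons (G : L → List L → N) (Z : L) (t : List L) :
    unshuffle₂ (fun a b => onSingleton (fun x => G x b) a) (Z :: t)
      = G Z t - unshuffle₂ (fun a b => onSingleton (fun x => G x (Z :: b)) a) t := by
  simp only [unshuffle₂, onSingleton_cons, neg_one_pow_smul_onSingleton, unshuffle₂_nil_left,
    unshuffle₂_neg, sub_eq_add_neg]

theorem unshuffle₂_onPair_cons (G : L → L → List L → N) (Z : L) (t : List L) :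
    unshuffle₂ (fun a b => onPair (fun x y => G x y b) a) (Z :: t)
      = unshuffle₂ (fun a b => onSingleton (fun y => G Z y b) a) t
        + unshuffle₂ (fun a b => onPair (fun x y => G x y (Z :: b)) a) t := by
  simp only [unshuffle₂, onPair_cons, neg_one_pow_smul_onPair]

end SmallLists

section Recursions

variable {L N : Type*} [AddCommGroup L] [AddCommGroup N]

theorem unshuffle₂_insert {ε : ℤˣ} {φ : List L → L} (hφ : HasSign ε φ) {f : List L → N}
    (hf : IsMultiadditive f) (hs : IsSkew f) (t : List L) :
    unshuffle₂ (fun a b => f (φ a :: b)) t = listInsert ε φ f t := by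
  induction t generalizing ε φ f with
  | nil => rfl
  | cons Z t ih =>
    have h : ∀ a b, (-1 : ℤˣ) ^ a.length • f (φ a :: Z :: b) = -ε • contr Z f (φ a :: b) :=
      fun a b => by
        rw [hφ.neg_one_pow_smul_comp (g := fun x => f (x :: Z :: b)) (hf.zero_cons _),
          contr_apply, Units.neg_smul, ← smul_neg]
        exact congrArg _ (hs [] Z (φ a) b)
    simp only [unshuffle₂, h]
    rw [unshuffle₂_smul, ih hφ (hf.contr Z) (hs.contr Z), Units.neg_smul, ← sub_eq_add_neg,
      listInsert_cons, ← ih (hφ.contr Z) hf hs]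
    rfl

theorem unshuffle₂_cup {ε : ℤˣ} {φ : List L → L} (hφ : HasSign ε φ) {B : L → L → N}
    (hB : ∀ y, B 0 y = 0) (ψ : List L → L) (t : List L) :
    unshuffle₂ (fun a b => B (φ a) (ψ b)) t = listCup B ε φ ψ t := by
  induction t generalizing ε φ ψ with
  | nil => rfl
  | cons Z t ih =>
    have h : ∀ a y, (-1 : ℤˣ) ^ a.length • B (φ a) y = ε • B (φ a) y := fun a y =>
      hφ.neg_one_pow_smul_comp (g := fun x => B x y) (hB y) a
    simp only [unshuffle₂, h, unshuffle₂_smul, listCup_cons, ← ih hφ, ← ih (hφ.contr Z),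
      contr_apply]

theorem unshuffle₃_curv {R : L → L → L → N} (hl : ∀ y z, R 0 y z = 0) (hr : ∀ x z, R x 0 z = 0)
    {ε δ : ℤˣ} {φ ψ : List L → L} (hφ : HasSign ε φ) (hψ : HasSign δ ψ) (t : List L) :
    unshuffle₃ (fun a b c => onSingleton (R (φ a) (ψ b)) c) t = listCurv R ε δ φ ψ t := by
  induction t generalizing ε δ φ ψ with
  | nil => rfl
  | cons Z t ih =>
    have h₁ : ∀ a y c, (-1 : ℤˣ) ^ a.length • onSingleton (R (φ a) y) c
        = ε • onSingleton (R (φ a) y) c := fun a y c =>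
      hφ.neg_one_pow_smul_comp (g := fun x => onSingleton (R x y) c)
        (by rw [show R 0 y = 0 from funext (hl y), map_zero, Pi.zero_apply]) a
    have h₂ : ∀ a b c, (-1 : ℤˣ) ^ (a.length + b.length) • onSingleton (R (φ a) (ψ b)) (Z :: c)
        = (ε * δ) • if c = [] then R (φ a) (ψ b) Z else 0 := fun a b c => by
      rw [onSingleton_cons, pow_add, mul_smul, mul_smul]
      split_ifs
      · rw [hψ.neg_one_pow_smul_comp (g := fun y => R (φ a) y Z) (hr _ _), smul_comm,
          hφ.neg_one_pow_smul_comp (g := fun x => R x (ψ b) Z) (hl _ _), smul_comm]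
      · simp only [smul_zero]
    simp only [unshuffle₃, h₁, h₂, unshuffle₃_smul, unshuffle₃_nil_right, listCurv]
    rw [unshuffle₂_cup (B := fun x y => R x y Z) hφ fun y => hl y Z,
      ← ih (hφ.contr Z) hψ, ← ih hφ (hψ.contr Z)]
    rfl

variable (cE : L →+ N →+ N) (br : L → L → L)

theorem listLie_eq_unshuffle₂ (Z : L) {f : List L → N} (hs : IsSkew f) (t : List L) :
    listLie cE br Z f t
      = cE Z (f t) - unshuffle₂ (fun a b => onSingleton (fun y => f (br Z y :: b)) a) t := by
  induction t generalizing f with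
  | nil => exact (sub_zero _).symm
  | cons Y t ih =>
    have h : ∀ b, (fun y => f (br Z y :: Y :: b)) = -fun y => contr Y f (br Z y :: b) :=
      fun b => funext fun y => hs [] _ _ b
    simp only [listLie_cons, ih (hs.contr Y), unshuffle₂_onSingleton_cons, h, map_neg,
      Pi.neg_apply, unshuffle₂_neg, contr_apply]
    abel

theorem listDeriv_eq_unshuffle₂ {f : List L → N} (hs : IsSkew f) (t : List L) :
    listDeriv cE br f t
      = unshuffle₂ (fun a b => onSingleton (fun x => cE x (f b)) a) t
        - unshuffle₂ (fun a b => onPair (fun x y => f (br x y :: b)) a) t := by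
  induction t generalizing f with
  | nil => exact (sub_zero _).symm
  | cons Z t ih =>
    have h : ∀ x y b, f (br x y :: Z :: b) = -contr Z f (br x y :: b) :=
      fun x y b => hs [] _ _ b
    simp only [listDeriv_cons, ih (hs.contr Z), unshuffle₂_onSingleton_cons,
      unshuffle₂_onPair_cons, listLie_eq_unshuffle₂ cE br Z hs, h, onPair_neg, unshuffle₂_neg,
      contr_apply]
    abel

end Recursions

section Degree

variable {L N : Type*} [AddCommGroup N]

/-- A function on lists has degree `n` if it vanishes on the lists of length `≠ n`. -/
def HasDegree (n : ℕ) (f : List L → N) : Prop := ∀ l, l.length ≠ n → f l = 0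

theorem HasDegree.hasSign {n : ℕ} {f : List L → N} (hf : HasDegree n f) :
    HasSign ((-1) ^ n) f :=
  fun l hl => hf l fun h => hl (by rw [h])

theorem exists_ofFn_eq {n : ℕ} {t : List L} (h : t.length = n) :
    ∃ v : Fin n → L, List.ofFn v = t := by
  subst h
  exact ⟨t.get, List.ofFn_get t⟩

theorem HasDegree.ext {n : ℕ} {f g : List L → N} (hf : HasDegree n f) (hg : HasDegree n g)
    (h : ∀ v : Fin n → L, f (List.ofFn v) = g (List.ofFn v)) : f = g := by
  funext t
  by_cases ht : t.length = n
  · obtain ⟨v, rfl⟩ := exists_ofFn_eq ht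
    exact h v
  · rw [hf t ht, hg t ht]

theorem HasDegree.isSkew {n : ℕ} {f : List L → N} (hf : HasDegree n f)
    (h : ∀ (v : Fin n → L) i j, i ≠ j →
      f (List.ofFn (v ∘ Equiv.swap i j)) = -f (List.ofFn v)) : IsSkew f := by
  intro l x y m
  by_cases hn : (l ++ x :: y :: m).length = n
  · obtain ⟨v, hv⟩ := exists_ofFn_eq hn
    have hlen : l.length + 1 < n := by grind
    have hswap : List.ofFn (v ∘ Equiv.swap ⟨l.length, by omega⟩ ⟨l.length + 1, hlen⟩)
        = l ++ y :: x :: m := by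
      refine List.ext_getElem (by grind) fun i h₁ h₂ => ?_
      have hget : ∀ j : Fin n, v j = (l ++ x :: y :: m)[j] := fun j => by
        simp [← hv]
      simp only [List.getElem_ofFn, Function.comp_apply, hget, Equiv.swap_apply_def, Fin.ext_iff]
      grind
    rw [← hv, ← hswap, h _ _ _ (by simp)]
  · rw [hf _ hn, hf _ (by grind), neg_zero]

theorem HasDegree.isMultiadditive [AddCommGroup L] {n : ℕ} {f : List L → N} (hf : HasDegree n f)
    (h : ∀ (v : Fin n → L) i x y, f (List.ofFn (Function.update v i (x + y)))
      = f (List.ofFn (Function.update v i x)) + f (List.ofFn (Function.update v i y))) :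
    IsMultiadditive f := by
  intro l x y m
  by_cases hn : (l ++ x :: m).length = n
  · obtain ⟨v, hv⟩ := exists_ofFn_eq hn
    have hlen : l.length < n := by grind
    have hupdate (z : L) : List.ofFn (Function.update v ⟨l.length, hlen⟩ z) = l ++ z :: m := by
      refine List.ext_getElem (by grind) fun i h₁ h₂ => ?_
      have hget : ∀ j : Fin n, v j = (l ++ x :: m)[j] := fun j => by simp [← hv]
      simp only [List.getElem_ofFn, Function.update_apply, hget, Fin.ext_iff]
      grind
    rw [← hupdate, ← hupdate, ← hupdate, h]
  · rw [hf _ hn, hf _ (by grind), hf _ (by grind), add_zero]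

end Degree

section Shuffles

variable {L N : Type*} [AddCommGroup N]

theorem sum_shuffles₂ {k n : ℕ} (hk : k ≤ n) {K : List L → List L → N}
    (hK : ∀ a b, a.length ≠ k → K a b = 0) (v : Fin n → L) :
    ∑ σ ∈ shuffles₂ k n, Equiv.Perm.sign σ •
        K ((List.ofFn (v ∘ σ)).take k) ((List.ofFn (v ∘ σ)).drop k)
      = unshuffle₂ K (List.ofFn v) := by
  have hshuffles : shuffles₂ k n = shuffles₃ 0 k n := by simp [shuffles₂, shuffles₃]
  have hnil : ∀ a b c : List L, ¬(a.length = 0 ∧ b.length = k) →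
      (if a = [] then K b c else 0) = 0 := fun a b c h => by
      split_ifs with ha
      · exact hK b c fun hb => h ⟨List.length_eq_zero_iff.2 ha, hb⟩
      · rfl
  rw [← unshuffle₃_nil_left, ← sum_shuffles₃ (by omega) hnil, hshuffles]
  simp only [onBlocks, List.take_zero, List.drop_zero, if_true]

theorem take_ofFn_add {k m : ℕ} (w : Fin (k + m) → L) :
    (List.ofFn w).take k = List.ofFn fun i => w (Fin.castAdd m i) := by
  rw [List.ofFn_add]
  exact List.take_left' (List.length_ofFn)

theorem drop_ofFn_add {k m : ℕ} (w : Fin (k + m) → L) :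
    (List.ofFn w).drop k = List.ofFn fun j => w (Fin.natAdd k j) := by
  rw [List.ofFn_add]
  exact List.drop_left' (List.length_ofFn)

variable [AddCommGroup L]

theorem insertFun_eq_listInsert {k m : ℕ} {φ : List L → L} (hφ : HasDegree k φ) {f : List L → N}
    (hf : IsMultiadditive f) (hs : IsSkew f) (v : Fin (k + m) → L) :
    insertFun (fun w : Fin k → L => φ (List.ofFn w)) (fun w : Fin (m + 1) → L => f (List.ofFn w)) v
      = listInsert ((-1) ^ k) φ f (List.ofFn v) := by
  rw [← unshuffle₂_insert hφ.hasSign hf hs, ← sum_shuffles₂ (Nat.le_add_right k m)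
    fun a b h => by rw [hφ a h, hf.zero_cons], insertFun]
  simp only [take_ofFn_add, drop_ofFn_add, List.ofFn_cons, Function.comp_apply]

theorem extDerivFun_eq_listDeriv (cE : L →+ N →+ N) (br : L → L → L) {f : List L → N}
    (hs : IsSkew f) {p : ℕ} (v : Fin (p + 1) → L) :
    extDerivFun (fun x s => cE x s) br (fun w : Fin p → L => f (List.ofFn w)) v
      = listDeriv cE br f (List.ofFn v) := by
  rw [listDeriv_eq_unshuffle₂ cE br hs, extDerivFun]
  congr 1
  · rw [← sum_shuffles₂ (Nat.le_add_left 1 p) fun a b h => onSingleton_of_length_ne h]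
    simp only [List.ofFn_succ, List.take_succ_cons, List.take_zero, List.drop_succ_cons,
      List.drop_zero, onSingleton_cons, if_true, Function.comp_apply]
  · cases p with
    | zero =>
      refine (unshuffle₂_eq_zero fun a b hab => onPair_of_length_ne ?_).symm
      rw [List.length_ofFn] at hab
      omega
    | succ q =>
      rw [← sum_shuffles₂ (Nat.le_add_left 2 q) fun a b h => onPair_of_length_ne h, bracketSum]
      simp only [List.ofFn_succ, List.take_succ_cons, List.take_zero, List.drop_succ_cons,
        List.drop_zero, onPair_cons, onSingleton_cons, if_true, Function.comp_apply, Fin.cons_zero,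
        Fin.cons_succ, Fin.succ_zero_eq_one]

theorem onSingleton_curv_eq_zero {R : L → L → L → N} (hl : ∀ y z, R 0 y z = 0)
    (hr : ∀ x z, R x 0 z = 0) {k l : ℕ} {φ ψ : List L → L} (hφ : HasDegree k φ)
    (hψ : HasDegree l ψ) {a b : List L} (h : ¬(a.length = k ∧ b.length = l)) (c : List L) :
    onSingleton (R (φ a) (ψ b)) c = 0 := by
  have hzero : R (φ a) (ψ b) = 0 := funext fun z => by
    rcases not_and_or.1 h with h | h
    · rw [hφ a h, hl, Pi.zero_apply]
    · rw [hψ b h, hr, Pi.zero_apply]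
  rw [hzero, map_zero, Pi.zero_apply]

theorem curvFun_eq_listCurv {R : L → L → L → L} (hl : ∀ y z, R 0 y z = 0)
    (hr : ∀ x z, R x 0 z = 0) {k l : ℕ} {φ ψ : List L → L} (hφ : HasDegree k φ)
    (hψ : HasDegree l ψ) (v : Fin (k + l + 1) → L) :
    curvFun R (fun w : Fin k → L => φ (List.ofFn w)) (fun w : Fin l → L => ψ (List.ofFn w)) v
      = listCurv R ((-1) ^ k) ((-1) ^ l) φ ψ (List.ofFn v) := by
  rw [← unshuffle₃_curv hl hr hφ.hasSign hψ.hasSign, ← sum_shuffles₃ (Nat.le_succ _)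
    fun a b c h => onSingleton_curv_eq_zero hl hr hφ hψ h c, curvFun]
  refine Finset.sum_congr rfl fun σ _ => ?_
  have hlast : (List.ofFn (v ∘ σ))
      = (List.ofFn fun i : Fin (k + l) => v (σ i.castSucc)) ++ [v (σ (Fin.last (k + l)))] := by
    rw [List.ofFn_succ_last]
    rfl
  have hdrop : ((List.ofFn fun i : Fin (k + l) => v (σ i.castSucc)).drop k).length = l := by
    rw [List.length_drop, List.length_ofFn, Nat.add_sub_cancel_left]
  rw [onBlocks, hlast, List.take_append_of_le_length (by rw [List.length_ofFn]; omega),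
    List.drop_append_of_le_length (by rw [List.length_ofFn]; omega), List.take_left' hdrop,
    List.drop_left' hdrop, take_ofFn_add, drop_ofFn_add, onSingleton_cons, if_pos rfl]

theorem HasDegree.listCurv {R : L → L → L → N} (hl : ∀ y z, R 0 y z = 0)
    (hr : ∀ x z, R x 0 z = 0) {k l : ℕ} {φ ψ : List L → L} (hφ : HasDegree k φ)
    (hψ : HasDegree l ψ) :
    HasDegree (k + l + 1) (listCurv R ((-1) ^ k) ((-1) ^ l) φ ψ) := fun t ht => by
  rw [← unshuffle₃_curv hl hr hφ.hasSign hψ.hasSign]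
  refine unshuffle₃_eq_zero fun a b c habc => ?_
  by_cases h : a.length = k ∧ b.length = l
  · exact onSingleton_of_length_ne (by omega)
  · exact onSingleton_curv_eq_zero hl hr hφ hψ h c

theorem HasDegree.listInsert {k m : ℕ} {φ : List L → L} (hφ : HasDegree k φ) {f : List L → N}
    (hf : IsMultiadditive f) (hs : IsSkew f) (hm : HasDegree (m + 1) f) :
    HasDegree (k + m) (listInsert ((-1) ^ k) φ f) := fun t ht => by
  rw [← unshuffle₂_insert hφ.hasSign hf hs]
  refine unshuffle₂_eq_zero fun a b hab => ?_
  by_cases h : a.length = k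
  · exact hm _ (by grind)
  · rw [hφ a h, hf.zero_cons]

theorem listInsert_eq_zero {ε : ℤˣ} {φ : List L → L} (hφ : HasSign ε φ) {f : List L → N}
    (hf : IsMultiadditive f) (hs : IsSkew f) (hm : HasDegree 0 f) : LieAlgd.listInsert ε φ f = 0 :=
  funext fun t => by
    rw [← unshuffle₂_insert hφ hf hs, unshuffle₂_eq_zero fun a b _ => hm _ (by simp), Pi.zero_apply]

theorem HasDegree.listDeriv (cE : L →+ N →+ N) (br : L → L → L) {p : ℕ} {f : List L → N}
    (hf : HasDegree p f) (hs : IsSkew f) : HasDegree (p + 1) (listDeriv cE br f) := fun t ht => by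
  rw [listDeriv_eq_unshuffle₂ cE br hs, unshuffle₂_eq_zero, unshuffle₂_eq_zero, sub_zero]
  · intro a b hab
    by_cases h : a.length = 2
    · have hzero : (fun x y => f (br x y :: b)) = 0 :=
        funext₂ fun x y => hf _ (by rw [List.length_cons]; omega)
      rw [hzero]
      match a with
      | [] | [_] | [_, _] | _ :: _ :: _ :: _ => rfl
    · exact onPair_of_length_ne h
  · intro a b hab
    by_cases h : a.length = 1
    · simp only [hf b (by omega), map_zero]
      exact congrFun (map_zero onSingleton) a
    · exact onSingleton_of_length_ne h

end Shuffles

section Forms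

variable {EM : Type*} [NormedAddCommGroup EM] [NormedSpace ℝ EM]
  {H : Type*} [TopologicalSpace H] {I : ModelWithCorners ℝ EM H}
  {M : Type*} [TopologicalSpace M] [ChartedSpace H M]
  {F : Type*} [NormedAddCommGroup F] [NormedSpace ℝ F]
  {A : M → Type*} [TopologicalSpace (TotalSpace F A)] [∀ x, AddCommGroup (A x)]
  [∀ x, Module ℝ (A x)] [∀ x, TopologicalSpace (A x)] [FiberBundle F A] [VectorBundle ℝ F A]
  {FE : Type*} [NormedAddCommGroup FE] [NormedSpace ℝ FE]
  {E : M → Type*} [TopologicalSpace (TotalSpace FE E)] [∀ x, AddCommGroup (E x)]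
  [∀ x, Module ℝ (E x)] [∀ x, TopologicalSpace (E x)] [FiberBundle FE E] [VectorBundle ℝ FE E]

/-- A form of mixed degree as a function on lists of sections: on a list of length `k` it is
its component of degree `k`. -/
def toList : Forms I F A FE E →+ List Cₛ^∞⟮I; F, A⟯ → Cₛ^∞⟮I; FE, E⟯ where
  toFun ζ t := ζ t.length t.get
  map_zero' := rfl
  map_add' _ _ := rfl

theorem toList_ofFn (ζ : Forms I F A FE E) {k : ℕ} (v : Fin k → Cₛ^∞⟮I; F, A⟯) :
    toList ζ (List.ofFn v) = ζ k v := by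
  have key : ∀ (t : List Cₛ^∞⟮I; F, A⟯) (ht : t.length = k),
      toList ζ t = ζ k fun i => t.get (i.cast ht.symm) := by
    rintro t rfl
    rfl
  rw [key _ List.length_ofFn]
  congr 1
  funext i
  simp only [List.get_eq_getElem, Fin.val_cast, List.getElem_ofFn]

theorem toList_injective :
    Function.Injective (toList : Forms I F A FE E →+ List Cₛ^∞⟮I; F, A⟯ → Cₛ^∞⟮I; FE, E⟯) :=
  fun ζ θ h => DFinsupp.ext fun k => AlternatingMap.ext fun v => by
    rw [← toList_ofFn, h, toList_ofFn]

theorem toList_neg_one_pow_smul (n : ℕ) (ζ : Forms I F A FE E) :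
    toList ((-1 : ℝ) ^ n • ζ) = (-1 : ℤˣ) ^ n • toList ζ := by
  rcases n.even_or_odd with h | h
  · simp only [h.neg_one_pow, one_smul]
  · simp only [h.neg_one_pow, neg_one_smul, Units.neg_smul, one_smul, map_neg]

theorem toList_homog_ofFn {k : ℕ} (η : Form I F A FE E k) (v : Fin k → Cₛ^∞⟮I; F, A⟯) :
    toList (homog k η) (List.ofFn v) = η v := by
  rw [toList_ofFn, homog, DirectSum.lof_apply]

theorem hasDegree_toList_homog {k : ℕ} (η : Form I F A FE E k) :
    HasDegree k (toList (homog k η)) := fun t ht => by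
  have h : homog k η t.length = 0 := DirectSum.of_eq_of_ne _ _ _ ht
  exact DFunLike.congr_fun h t.get

theorem homog_induction {P : Forms I F A FE E → Prop} (ζ : Forms I F A FE E) (zero : P 0)
    (homog : ∀ k η, P (homog k η)) (add : ∀ ζ θ, P ζ → P θ → P (ζ + θ)) : P ζ :=
  DirectSum.induction_on ζ zero homog add

theorem isMultiadditive_toList (ζ : Forms I F A FE E) : IsMultiadditive (toList ζ) := by
  induction ζ using homog_induction with
  | zero => exact fun _ _ _ _ => (add_zero 0).symm
  | homog k η =>
    refine (hasDegree_toList_homog η).isMultiadditive fun v i x y => ?_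
    simp only [toList_homog_ofFn, η.map_update_add]
  | add ζ θ hζ hθ =>
    intro l x y m
    simp only [map_add, Pi.add_apply, hζ l x y m, hθ l x y m]
    abel

theorem isSkew_toList (ζ : Forms I F A FE E) : IsSkew (toList ζ) := by
  induction ζ using homog_induction with
  | zero => exact fun _ _ _ _ => neg_zero.symm
  | homog k η =>
    refine (hasDegree_toList_homog η).isSkew fun v i j hij => ?_
    simp only [toList_homog_ofFn, η.map_swap v hij]
  | add ζ θ hζ hθ =>
    intro l x y m
    simp only [map_add, Pi.add_apply, hζ l x y m, hθ l x y m]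
    abel

variable [IsManifold I ∞ M]

theorem interior_homog_zero {k : ℕ} (φ : Form I F A F A k) (η : Form I F A FE E 0) :
    interior k φ (homog 0 η) = 0 :=
  DirectSum.toModule_lof ℝ 0 η

theorem interior_homog_succ {k m : ℕ} (φ : Form I F A F A k) (η : Form I F A FE E (m + 1)) :
    interior k φ (homog (m + 1) η) = homog (k + m) (insertForm φ η) :=
  DirectSum.toModule_lof ℝ (m + 1) η

theorem toList_interior {k : ℕ} (φ : Form I F A F A k) (ζ : Forms I F A FE E) :
    toList (interior k φ ζ) = listInsert ((-1) ^ k) (toList (homog k φ)) (toList ζ) := by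
  induction ζ using homog_induction with
  | zero => simp only [map_zero]
  | homog m η =>
    have hφ := hasDegree_toList_homog φ
    have hη := hasDegree_toList_homog η
    have hadd := isMultiadditive_toList (homog m η)
    have hs := isSkew_toList (homog m η)
    cases m with
    | zero => rw [interior_homog_zero, map_zero, listInsert_eq_zero hφ.hasSign hadd hs hη]
    | succ m =>
      rw [interior_homog_succ]
      refine (hasDegree_toList_homog _).ext (hφ.listInsert hadd hs hη) fun v => ?_
      rw [toList_homog_ofFn, insertForm_apply, ← insertFun_eq_listInsert hφ hadd hs]
      simp only [toList_homog_ofFn]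
  | add ζ θ hζ hθ => simp only [map_add, hζ, hθ]

variable {𝒜 : LieAlgebroid I F A}

/-- A connection as a biadditive map. -/
def Connection.biadd (D : Connection FE E 𝒜) :
    Cₛ^∞⟮I; F, A⟯ →+ Cₛ^∞⟮I; FE, E⟯ →+ Cₛ^∞⟮I; FE, E⟯ :=
  AddMonoidHom.mk' (fun X => AddMonoidHom.mk' (D.cov X) (D.cov_add X))
    fun X Y => AddMonoidHom.ext (D.add_cov X Y)

theorem extDeriv_homog (D : Connection FE E 𝒜) {p : ℕ} (η : Form I F A FE E p) :
    extDeriv D (homog p η) = homog (p + 1) (extDerivForm D η) :=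
  DirectSum.toModule_lof ℝ p η

theorem toList_extDeriv (D : Connection FE E 𝒜) (ζ : Forms I F A FE E) :
    toList (extDeriv D ζ) = listDeriv D.biadd 𝒜.bracket (toList ζ) := by
  induction ζ using homog_induction with
  | zero => simp only [map_zero]
  | homog p η =>
    have hη := hasDegree_toList_homog η
    have hs := isSkew_toList (homog p η)
    rw [extDeriv_homog]
    refine (hasDegree_toList_homog _).ext (hη.listDeriv D.biadd 𝒜.bracket hs) fun v => ?_
    rw [toList_homog_ofFn, extDerivForm_apply, ← extDerivFun_eq_listDeriv D.biadd 𝒜.bracket hs]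
    simp only [toList_homog_ofFn]
    rfl
  | add ζ θ hζ hθ => simp only [map_add, hζ, hθ]

theorem nabla_homog (DA : Connection F A 𝒜) (D : Connection FE E 𝒜) {k : ℕ}
    (φ : Form I F A F A k) (ζ : Forms I F A FE E) :
    nabla DA D (homog k φ) ζ = interior k φ (extDeriv D ζ)
      + (-1 : ℝ) ^ k • extDeriv D (interior k φ ζ)
      - (-1 : ℝ) ^ k • interior (k + 1) (extDerivForm DA φ) ζ :=
  LinearMap.congr_fun (DirectSum.toModule_lof ℝ k φ) ζ

theorem exists_nabla_homog_eq_homog (DA : Connection F A 𝒜) (D : Connection FE E 𝒜) {k l : ℕ}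
    (φ : Form I F A F A k) (η : Form I F A FE E l) :
    ∃ θ, nabla DA D (homog k φ) (homog l η) = homog (k + l) θ := by
  suffices h : nabla DA D (homog k φ) (homog l η) ∈ LinearMap.range (homog (k + l)) by
    obtain ⟨θ, hθ⟩ := h
    exact ⟨θ, hθ.symm⟩
  rw [nabla_homog]
  refine Submodule.sub_mem _ (Submodule.add_mem _ ?_ (Submodule.smul_mem _ _ ?_))
    (Submodule.smul_mem _ _ ?_)
  · rw [extDeriv_homog, interior_homog_succ]
    exact LinearMap.mem_range_self _ _
  · cases l with
    | zero =>
      rw [interior_homog_zero, map_zero]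
      exact Submodule.zero_mem _
    | succ m =>
      rw [interior_homog_succ, extDeriv_homog]
      exact LinearMap.mem_range_self _ _
  · cases l with
    | zero =>
      rw [interior_homog_zero]
      exact Submodule.zero_mem _
    | succ m =>
      rw [interior_homog_succ, show k + (m + 1) = k + 1 + m by omega]
      exact LinearMap.mem_range_self _ _

theorem toList_nabla_homog {DA : Connection F A 𝒜} (hDA : DA.IsTorsionFree)
    (D : Connection FE E 𝒜) {k : ℕ} (φ : Form I F A F A k) (ζ : Forms I F A FE E) :
    toList (nabla DA D (homog k φ) ζ)
      = listNabla DA.biadd D.biadd ((-1) ^ k) (toList (homog k φ)) (toList ζ) := by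
  rw [listNabla_eq DA.biadd D.biadd (fun X Y => (hDA X Y).symm) _ _ (isMultiadditive_toList ζ),
    nabla_homog, map_sub, map_add, toList_neg_one_pow_smul, toList_neg_one_pow_smul,
    toList_interior, toList_extDeriv, toList_extDeriv, toList_interior, toList_interior,
    ← extDeriv_homog, toList_extDeriv, pow_succ, mul_neg_one]

theorem toList_nabla_nabla_homog {DA : Connection F A 𝒜} (hDA : DA.IsTorsionFree)
    (D : Connection FE E 𝒜) {k l : ℕ} (φ : Form I F A F A k) (ψ : Form I F A F A l)
    (ζ : Forms I F A FE E) :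
    toList (nabla DA D (nabla DA DA (homog k φ) (homog l ψ)) ζ)
      = listNabla DA.biadd D.biadd ((-1) ^ (k + l))
        (listNabla DA.biadd DA.biadd ((-1) ^ k) (toList (homog k φ)) (toList (homog l ψ)))
        (toList ζ) := by
  obtain ⟨θ, hθ⟩ := exists_nabla_homog_eq_homog DA DA φ ψ
  rw [hθ, toList_nabla_homog hDA, ← hθ, toList_nabla_homog hDA]

theorem Connection.IsTorsionFree.curvature_eq {DA : Connection F A 𝒜} (hDA : DA.IsTorsionFree) :
    DA.curvature = torsionFreeCurvature DA.biadd := by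
  funext X Y Z
  rw [Connection.curvature, ← hDA X Y]
  rfl

theorem toList_curvForm {DA : Connection F A 𝒜} (hDA : DA.IsTorsionFree) {k l : ℕ}
    (φ : Form I F A F A k) (ψ : Form I F A F A l) :
    toList (homog (k + l + 1) (curvForm DA φ ψ)) = listCurv (torsionFreeCurvature DA.biadd)
      ((-1) ^ k) ((-1) ^ l) (toList (homog k φ)) (toList (homog l ψ)) := by
  have hl : ∀ Y Z, torsionFreeCurvature DA.biadd 0 Y Z = 0 := by simp [torsionFreeCurvature]
  have hr : ∀ X Z, torsionFreeCurvature DA.biadd X 0 Z = 0 := by simp [torsionFreeCurvature]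
  have hφ := hasDegree_toList_homog φ
  have hψ := hasDegree_toList_homog ψ
  refine (hasDegree_toList_homog _).ext (hφ.listCurv hl hr hψ) fun v => ?_
  rw [toList_homog_ofFn, curvForm_apply, hDA.curvature_eq, ← curvFun_eq_listCurv hl hr hφ hψ]
  simp only [toList_homog_ofFn]

theorem Connection.IsFlat.biadd_comm {DA : Connection F A 𝒜} (hDA : DA.IsTorsionFree)
    {DE : Connection FE E 𝒜} (hDE : DE.IsFlat) (X Y : Cₛ^∞⟮I; F, A⟯) (s : Cₛ^∞⟮I; FE, E⟯) :
    DE.biadd X (DE.biadd Y s) - DE.biadd Y (DE.biadd X s)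
      - DE.biadd (DA.biadd X Y - DA.biadd Y X) s = 0 := by
  have h := hDE X Y s
  rwa [Connection.curvature, ← hDA X Y] at h

end Forms

end LieAlgd

end

theorem theorem2_general
    {EM : Type*} [NormedAddCommGroup EM] [NormedSpace ℝ EM]
    {H : Type*} [TopologicalSpace H] {I : ModelWithCorners ℝ EM H}
    {M : Type*} [TopologicalSpace M] [ChartedSpace H M] [IsManifold I ∞ M]
    {F : Type*} [NormedAddCommGroup F] [NormedSpace ℝ F]
    {A : M → Type*} [TopologicalSpace (Bundle.TotalSpace F A)] [∀ x, AddCommGroup (A x)]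
    [∀ x, Module ℝ (A x)] [∀ x, TopologicalSpace (A x)] [FiberBundle F A] [VectorBundle ℝ F A]
    {FE : Type*} [NormedAddCommGroup FE] [NormedSpace ℝ FE]
    {E : M → Type*} [TopologicalSpace (Bundle.TotalSpace FE E)] [∀ x, AddCommGroup (E x)]
    [∀ x, Module ℝ (E x)] [∀ x, TopologicalSpace (E x)] [FiberBundle FE E]
    [VectorBundle ℝ FE E]
    (𝒜 : LieAlgd.LieAlgebroid I F A)
    (DA : LieAlgd.Connection F A 𝒜) (hDA : DA.IsTorsionFree)
    (DE : LieAlgd.Connection FE E 𝒜) (hDE : DE.IsFlat)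
    (k l : ℕ) (φ : LieAlgd.Form I F A F A k) (ψ : LieAlgd.Form I F A F A l) :
    LieAlgd.gradedCommutator k l
        (LieAlgd.nabla DA DE (LieAlgd.homog k φ)) (LieAlgd.nabla DA DE (LieAlgd.homog l ψ))
      = LieAlgd.nabla DA DE (LieAlgd.nabla DA DA (LieAlgd.homog k φ) (LieAlgd.homog l ψ))
        - (-1 : ℝ) ^ (k * l) •
          LieAlgd.nabla DA DE (LieAlgd.nabla DA DA (LieAlgd.homog l ψ) (LieAlgd.homog k φ))
        - LieAlgd.interior (k + l + 1) (LieAlgd.curvForm DA φ ψ) := by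
  refine LinearMap.ext fun ζ => LieAlgd.toList_injective ?_
  have h := LieAlgd.listNabla_listNabla DA.biadd DE.biadd (hDE.biadd_comm hDA)
    (LieAlgd.hasDegree_toList_homog φ).hasSign (LieAlgd.hasDegree_toList_homog ψ).hasSign
    (LieAlgd.isMultiadditive_toList ζ) (LieAlgd.isSkew_toList ζ)
  simp only [LieAlgd.koszulSign_neg_one_pow, ← pow_add] at h
  simp only [LieAlgd.gradedCommutator, LinearMap.sub_apply, LinearMap.smul_apply,
    Module.End.mul_apply, map_sub, LieAlgd.toList_neg_one_pow_smul,
    LieAlgd.toList_nabla_nabla_homog hDA, LieAlgd.toList_nabla_homog hDA, LieAlgd.toList_interior,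
    LieAlgd.toList_curvForm hDA, h, pow_succ, mul_neg_one, add_comm l k]

theorem theorem2
    {EM : Type*} [NormedAddCommGroup EM] [NormedSpace ℝ EM] [FiniteDimensional ℝ EM]
    {H : Type*} [TopologicalSpace H] {I : ModelWithCorners ℝ EM H}
    {M : Type*} [TopologicalSpace M] [ChartedSpace H M] [IsManifold I ∞ M] [T2Space M]
    {F : Type*} [NormedAddCommGroup F] [NormedSpace ℝ F] [FiniteDimensional ℝ F]
    {A : M → Type*} [TopologicalSpace (Bundle.TotalSpace F A)] [∀ x, AddCommGroup (A x)]
    [∀ x, Module ℝ (A x)] [∀ x, TopologicalSpace (A x)] [FiberBundle F A] [VectorBundle ℝ F A]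
    [ContMDiffVectorBundle ∞ F A I]
    {FE : Type*} [NormedAddCommGroup FE] [NormedSpace ℝ FE] [FiniteDimensional ℝ FE]
    {E : M → Type*} [TopologicalSpace (Bundle.TotalSpace FE E)] [∀ x, AddCommGroup (E x)]
    [∀ x, Module ℝ (E x)] [∀ x, TopologicalSpace (E x)] [FiberBundle FE E]
    [VectorBundle ℝ FE E] [ContMDiffVectorBundle ∞ FE E I]
    (𝒜 : LieAlgd.LieAlgebroid I F A)
    (DA : LieAlgd.Connection F A 𝒜) (hDA : DA.IsTorsionFree)
    (DE : LieAlgd.Connection FE E 𝒜) (hDE : DE.IsFlat)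
    (k l : ℕ) (φ : LieAlgd.Form I F A F A k) (ψ : LieAlgd.Form I F A F A l) :
    LieAlgd.gradedCommutator k l
        (LieAlgd.nabla DA DE (LieAlgd.homog k φ)) (LieAlgd.nabla DA DE (LieAlgd.homog l ψ))
      = LieAlgd.nabla DA DE (LieAlgd.nabla DA DA (LieAlgd.homog k φ) (LieAlgd.homog l ψ))
        - (-1 : ℝ) ^ (k * l) •
          LieAlgd.nabla DA DE (LieAlgd.nabla DA DA (LieAlgd.homog l ψ) (LieAlgd.homog k φ))
        - LieAlgd.interior (k + l + 1) (LieAlgd.curvForm DA φ ψ) :=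
  theorem2_general 𝒜 DA hDA DE hDE k l φ ψ
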